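/- **Setting.** Let $\mathcal C$ be a (locally small) cocomplete category, let $\mathcal C^{\mathbf 2}$ be its arrow category, and let $J$ be a small set (more generally a small family) of maps of $\mathcal C$. *Functorial factorisations.* A functorial factorisation $(E,\lambda,\rho)$ on $\mathcal C$ is a functor $E:\mathcal C^{\mathbf 2}\to\mathcal C$ with natural transformations $\lambda:\mathrm{dom}\Rightarrow E$, $\rho:E\Rightarrow\mathrm{cod}$ such that $\rho_f\lambda_f=f$. It induces functors $L,R:\mathcal C^{\mathbf 2}\to\mathcal C^{\mathbf 2}$, $Lf=\lambda_f$, $Rf=\rho_f$, with a copoint $\Phi_f=(1,\rho_f):Lf\to f$ and a point $\Lambda_f=(\lambda_f,1):f\to Rf$. A *comonad over $\mathrm{dom}$* is a functorial factorisation with an extension of $(L,\Phi)$ to a comonad $\mathsf L=(L,\Phi,\Sigma)$ with $\Sigma_f=(1,\sigma_f)$. These form a category $\mathbf{Comon}$, whose morphisms are the maps of functorial factorisations (natural $\gamma_f:Ef\to E'f$ commuting with $\lambda,\rho$) that are also maps of comonads. It is monoidal: $(E',\lambda',\rho',\sigma')\otimes(E,\lambda,\rho,\sigma)$ factorises $f$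 as $X\xrightarrow{\lambda_f}Ef\xrightarrow{\lambda'_{Rf}}E'Rf\xrightarrow{\rho'_{Rf}}Y$, with comultiplication $E'\bigl(E(1,\lambda'_{Rf})\,\sigma_f,\,1\bigr)\cdot\sigma'_{Rf}$, and the unit $I$, which is initial, factorises $f$ as $1_X$ followed by $f$. A *natural weak factorisation system* (n.w.f.s.) $(\mathsf L,\mathsf R,\Delta)$ consists of a comonad $\mathsf L$ over $\mathrm{dom}$ and maps $\pi_f:ERf\to Ef$ such that $\Pi_f=(\pi_f,1)$ extends $(R,\Lambda)$ to a monad $\mathsf R=(R,\Lambda,\Pi)$ and the maps $\Delta_f=(\sigma_f,\pi_f):LRf\to RLf$ form a distributive law; equivalently, it is a $\otimes$-monoid in $\mathbf{Comon}$. An *$\mathsf L$-map* structure on $f:X\to Y$ is a map $s:Y\to Ef$ such that $(1,s):f\to Lf$ is an $\mathsf L$-coalgebra. An *$\mathsf R$-map* $(g,p)$ is an $\mathsf R$-algebra, with structure map $(p,1):Rg\to g$; these form a category $\mathsf R\text{-}\mathbf{Map}$ with forgetful functor $U_{\mathsf R}$ to $\mathcal C^{\mathbf 2}$. *Right lifting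 data.* For $g:C\to D$ let $S_g$ be the set of all squares $x=(h,k):f\to g$ with $f:A\to B$ in $J$. Right lifting data for $g$ is a function $\delta$ assigning to each $x\in S_g$ a map $\delta(x):B\to C$ with $\delta(x)f=h$ and $g\,\delta(x)=k$. The pairs $(g,\delta)$ are the objects of a category $J^{\square}$; a morphism $(g,\delta)\to(g',\delta')$ is a square $(m,n):g\to g'$ with $m\,\delta(x)=\delta'((m,n)\cdot x)$ for all $x\in S_g$. Let $U_J:J^\square\to\mathcal C^{\mathbf 2}$ be the forgetful functor. Given $\mathsf L$-map structures $\alpha_f$ on the members $f$ of $J$, there is a functor $\theta:\mathsf R\text{-}\mathbf{Map}\to J^\square$ over $\mathcal C^{\mathbf 2}$ that sends $(g,p)$ to $(g,\delta)$ with $\delta(x)=p\cdot E(h,k)\cdot\alpha_f$ for $x=(h,k):f\to g$. The n.w.f.s. is *cofibrantly generated by $(J,\alpha)$* if $\theta$ is an isomorphism of categories. *The one-step comonad.* For each $g:C\to D$ let $E^1g$ be the pushout of $\sum_{x\in S_g}A_x\to\sum_{x\in S_g}B_x$ along $\langle h_x\rangle:\sum_{x}A_x\to C$, with $\lambda^1_g:C\to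 E^1g$ the coprojection and $\rho^1_g:E^1g\to D$ induced by $g$ and the $k_x$. Let $\sigma^1_g:E^1g\to E^1(\lambda^1_g)$ be given by $\lambda^1_{\lambda^1_g}$ on $C$, and on the summand $B_x$ by the coprojection at the square $(h_x,\,B_x\to E^1g):f_x\to\lambda^1_g$. This is an object $\mathsf L^1$ of $\mathbf{Comon}$, with a unique point $\tau:I\to\mathsf L^1$. Each $f:A\to B$ in $J$ has a canonical $\mathsf L^1$-map structure $\alpha_f:B\to E^1f$, the coprojection at $1_f\in S_f$. *The generated n.w.f.s.* The free $\mathsf L^1$-module sequence on $I$ is the transfinite sequence $(\mathsf L^a)$ in $\mathbf{Comon}$, indexed by the (small) ordinals, with connecting maps $X_{a,b}:\mathsf L^a\to\mathsf L^b$ and natural actions $\theta_a:\mathsf L^1\otimes\mathsf L^a\to\mathsf L^{a^+}$ satisfying $\theta_a\cdot(\tau\otimes\mathsf L^a)=X_{a,a^+}$, given as follows: $\mathsf L^0=I$; $\theta_0$ is invertible; $\theta_{a^+}$ is the coequaliser of $(\tau\otimes\mathsf L^{a^+})\cdot\theta_a$ and $\mathsf L^1\otimes(\theta_a\cdot(\tau\otimes\mathsf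 L^a))$, as maps $\mathsf L^1\otimes\mathsf L^a\rightrightarrows\mathsf L^1\otimes\mathsf L^{a^+}$; and for a limit ordinal $c$, $\mathsf L^c=\operatorname{colim}_{a<c}\mathsf L^a$ and $\theta_c$ is the coequaliser of the two maps $\operatorname{colim}_{a<c}(\mathsf L^1\otimes\mathsf L^a)\rightrightarrows\mathsf L^1\otimes\mathsf L^c$ with components $(\tau\otimes\mathsf L^c)\cdot X_{a^+,c}\cdot\theta_a$ and $\mathsf L^1\otimes X_{a,c}$. Assume that it *converges pointwise*: for every $f\in\mathcal C^{\mathbf 2}$ there is an ordinal $a$ such that the component $E^af\to E^{a^+}f$ of $X_{a,a^+}$ is invertible. Let the $\otimes$-monoid $(\mathsf L,\eta,\mu)$ in $\mathbf{Comon}$ be free on the pointed object $(\mathsf L^1,\tau)$, via $\chi:\mathsf L^1\to\mathsf L$: that is, $\chi\tau=\eta$, and for each $\otimes$-monoid $\mathsf M$ and each $\psi:\mathsf L^1\to\mathsf M$ for which $\psi\tau$ is the unit of $\mathsf M$, there is a unique monoid morphism $\varphi:\mathsf L\to\mathsf M$ with $\varphi\chi=\psi$. The corresponding n.w.f.s.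 $(\mathsf L,\mathsf R,\Delta)$ is the *n.w.f.s. generated by $J$*. Let $\beta_f=\chi_f\cdot\alpha_f$ be the induced $\mathsf L$-map structure on each $f$ in $J$. **Proposition.** The n.w.f.s. $(\mathsf L,\mathsf R,\Delta)$ generated by $J$ is cofibrantly generated by $(J,\beta)$: the functor $\theta:\mathsf R\text{-}\mathbf{Map}\to J^\square$ determined by $\beta$ satisfies $U_J\,\theta=U_{\mathsf R}$ and is an isomorphism of categories. -/

import Mathlib

open CategoryTheory Limits MonoidalCategory

universe v u

namespace Garner

/-- A functorial factorisation `(E, λ, ρ)` on `C`: a functor `E : Arrow C ⥤ C` with natural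
transformations `λ : dom ⟶ E` and `ρ : E ⟶ cod` (given by components) whose composite is the
canonical transformation `dom ⟶ cod`. -/
structure FunFact (C : Type u) [Category.{v} C] where
  E : Arrow C ⥤ C
  lam (f : Arrow C) : f.left ⟶ E.obj f
  rho (f : Arrow C) : E.obj f ⟶ f.right
  lam_nat {f g : Arrow C} (s : f ⟶ g) : lam f ≫ E.map s = s.left ≫ lam g
  rho_nat {f g : Arrow C} (s : f ⟶ g) : E.map s ≫ rho g = rho f ≫ s.right
  fac (f : Arrow C) : lam f ≫ rho f = f.hom

namespace FunFact

variable {C : Type u} [Category.{v} C] (F : FunFact C)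

attribute [simp] FunFact.fac

/-- The functor `L`, sending `f : X ⟶ Y` to `λ_f : X ⟶ E f`. -/
abbrev L : Arrow C ⥤ Arrow C where
  obj f := Arrow.mk (F.lam f)
  map s := Arrow.homMk s.left (F.E.map s) (F.lam_nat s).symm

/-- The functor `R`, sending `f : X ⟶ Y` to `ρ_f : E f ⟶ Y`. -/
abbrev R : Arrow C ⥤ Arrow C where
  obj f := Arrow.mk (F.rho f)
  map s := Arrow.homMk (F.E.map s) s.right (F.rho_nat s)

/-- The copoint `Φ_f = (1, ρ_f) : L f ⟶ f`. -/
abbrev Phi (f : Arrow C) : Arrow.mk (F.lam f) ⟶ f :=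
  Arrow.homMk (𝟙 f.left) (F.rho f)

/-- The point `Λ_f = (λ_f, 1) : f ⟶ R f`. -/
abbrev Lambda (f : Arrow C) : f ⟶ Arrow.mk (F.rho f) :=
  Arrow.homMk (F.lam f) (𝟙 f.right)

end FunFact

/-- A functorial factorisation together with an extension of the copointed endofunctor `(L, Φ)`
to a comonad over `dom`: the comultiplication is `Σ_f = (1, σ_f) : L f ⟶ L L f`. -/
structure DomComonad (C : Type u) [Category.{v} C] extends FunFact C where
  sigma (f : Arrow C) : E.obj f ⟶ E.obj (Arrow.mk (lam f))
  lam_sigma (f : Arrow C) : lam f ≫ sigma f = lam (Arrow.mk (lam f))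
  sigma_nat {f g : Arrow C} (s : f ⟶ g) :
    E.map s ≫ sigma g = sigma f ≫ E.map (toFunFact.L.map s)
  sigma_rho (f : Arrow C) : sigma f ≫ rho (Arrow.mk (lam f)) = 𝟙 (E.obj f)
  sigma_Phi (f : Arrow C) : sigma f ≫ E.map (toFunFact.Phi f) = 𝟙 (E.obj f)
  coassoc (f : Arrow C) :
    sigma f ≫ E.map (Arrow.homMk (𝟙 f.left) (sigma f) (by simp [lam_sigma]) :
      Arrow.mk (lam f) ⟶ Arrow.mk (lam (Arrow.mk (lam f)))) =
    sigma f ≫ sigma (Arrow.mk (lam f))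

namespace DomComonad

variable {C : Type u} [Category.{v} C]

attribute [simp] lam_sigma sigma_rho sigma_Phi

/-- `Σ_f = (1, σ_f)`. -/
abbrev Sig (A : DomComonad C) (f : Arrow C) :
    Arrow.mk (A.lam f) ⟶ Arrow.mk (A.lam (Arrow.mk (A.lam f))) :=
  Arrow.homMk (𝟙 f.left) (A.sigma f)

theorem coassoc' (A : DomComonad C) (f : Arrow C) :
    A.sigma f ≫ A.E.map (A.Sig f) = A.sigma f ≫ A.sigma (Arrow.mk (A.lam f)) := A.coassoc f

/-- The comonad `(L, Φ, Σ)` on the arrow category. -/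
def comonad (A : DomComonad C) : Comonad (Arrow C) where
  toFunctor := A.L
  ε := { app := A.Phi, naturality := fun f g s => by ext <;> simp [A.rho_nat] }
  δ := { app := A.Sig, naturality := fun f g s => by ext <;> simp [A.sigma_nat] }
  coassoc f := by ext <;> simp [A.coassoc']
  left_counit f := by ext <;> simp
  right_counit f := by ext <;> simp

/-- Morphisms: maps of functorial factorisations that are also maps of comonads. -/
structure Hom (A B : DomComonad C) where
  app (f : Arrow C) : A.E.obj f ⟶ B.E.obj f
  nat {f g : Arrow C} (s : f ⟶ g) : A.E.map s ≫ app g = app f ≫ B.E.map s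
  lam (f : Arrow C) : A.lam f ≫ app f = B.lam f
  rho (f : Arrow C) : app f ≫ B.rho f = A.rho f
  sigma (f : Arrow C) :
    app f ≫ B.sigma f =
      A.sigma f ≫ A.E.map (Arrow.homMk (𝟙 f.left) (app f) (by simp [lam]) :
        Arrow.mk (A.lam f) ⟶ Arrow.mk (B.lam f)) ≫ app (Arrow.mk (B.lam f))

attribute [simp] Hom.lam Hom.rho

/-- The component `(1, α_f) : L f ⟶ L' f` of the map of comonads underlying `α`. -/
abbrev Hom.mapL {A B : DomComonad C} (a : Hom A B) (f : Arrow C) :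
    Arrow.mk (A.lam f) ⟶ Arrow.mk (B.lam f) :=
  Arrow.homMk (𝟙 f.left) (a.app f)

/-- The component `(α_f, 1) : R f ⟶ R' f` of the map of pointed endofunctors underlying `α`. -/
abbrev Hom.mapR {A B : DomComonad C} (a : Hom A B) (f : Arrow C) :
    Arrow.mk (A.rho f) ⟶ Arrow.mk (B.rho f) :=
  Arrow.homMk (a.app f) (𝟙 f.right)

theorem Hom.sigma' {A B : DomComonad C} (a : Hom A B) (f : Arrow C) :
    a.app f ≫ B.sigma f =
      A.sigma f ≫ A.E.map (a.mapL f) ≫ a.app (Arrow.mk (B.lam f)) := a.sigma f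

theorem Hom.ext' {A B : DomComonad C} {a b : Hom A B} (h : ∀ f, a.app f = b.app f) : a = b := by
  cases a; cases b
  congr
  exact funext h

def Hom.id (A : DomComonad C) : Hom A A where
  app f := 𝟙 (A.E.obj f)
  nat s := by simp
  lam f := by simp
  rho f := by simp
  sigma f := by
    have : (Arrow.homMk (𝟙 f.left) (𝟙 (A.E.obj f)) (by simp) :
        Arrow.mk (A.lam f) ⟶ Arrow.mk (A.lam f)) = 𝟙 _ := by
      ext <;> simp
    rw [this]; simp

def Hom.comp {A B D : DomComonad C} (a : Hom A B) (b : Hom B D) : Hom A D where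
  app f := a.app f ≫ b.app f
  nat s := by rw [reassoc_of% a.nat s, b.nat s, Category.assoc]
  lam f := by simp [reassoc_of% a.lam]
  rho f := by simp
  sigma f := by
    have : (Arrow.homMk (𝟙 f.left) (a.app f ≫ b.app f)
          (by simp [reassoc_of% a.lam]) : Arrow.mk (A.lam f) ⟶ Arrow.mk (D.lam f)) = a.mapL f ≫ b.mapL f := by
      ext <;> simp
    rw [this]
    simp only [Category.assoc, b.sigma', reassoc_of% a.sigma',
      Functor.map_comp, reassoc_of% a.nat]

instance : Category (DomComonad C) where
  Hom := Hom
  id := Hom.id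
  comp := Hom.comp
  id_comp _ := Hom.ext' fun _ => Category.id_comp _
  comp_id _ := Hom.ext' fun _ => Category.comp_id _
  assoc _ _ _ := Hom.ext' fun _ => Category.assoc _ _ _

theorem hom_ext {A B : DomComonad C} {a b : A ⟶ B}
    (h : ∀ f, Hom.app a f = Hom.app b f) : a = b := Hom.ext' h

@[simp] theorem id_app (A : DomComonad C) (f : Arrow C) :
    Hom.app (𝟙 A) f = 𝟙 (A.E.obj f) := rfl

@[simp] theorem comp_app {A B D : DomComonad C} (a : A ⟶ B) (b : B ⟶ D) (f : Arrow C) :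
    Hom.app (a ≫ b) f = Hom.app a f ≫ Hom.app b f := rfl

/-- The unit object: `f : X ⟶ Y` is factorised as `1_X` followed by `f`. -/
abbrev unitObj (C : Type u) [Category.{v} C] : DomComonad C where
  E := { obj := fun f => f.left, map := fun s => s.left }
  lam f := 𝟙 f.left
  rho f := f.hom
  lam_nat s := by simp
  rho_nat s := by simp
  fac f := by simp
  sigma f := 𝟙 f.left
  lam_sigma f := by simp
  sigma_nat s := by simp
  sigma_rho f := by simp
  sigma_Phi f := by simp
  coassoc f := by simp

/-- The unique morphism out of the unit object. -/
def fromUnit (A : DomComonad C) : unitObj C ⟶ A where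
  app f := A.lam f
  nat s := (A.lam_nat s).symm
  lam f := Category.id_comp _
  rho f := A.fac f
  sigma f := by
    simp only [lam_sigma, Arrow.homMk_left]
    exact ((Category.id_comp _).trans (Category.id_comp _)).symm

section Tensor

variable (A B : DomComonad C)

/-- The composite factorisation `A ⊗ B`: factorise `f` by `B`, and then the right half by `A`. -/
abbrev tensorFact : FunFact C where
  E := B.R ⋙ A.E
  lam f := B.lam f ≫ A.lam (Arrow.mk (B.rho f))
  rho f := A.rho (Arrow.mk (B.rho f))
  lam_nat s := by
    have := A.lam_nat (B.R.map s)
    simp at this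
    simp [this, reassoc_of% B.lam_nat s]
  rho_nat s := by simpa using A.rho_nat (B.R.map s)
  fac f := by simp

/-- The map `(1, λ_{R f})` from the left half of the `B`-factorisation of `f` to the left
half of its `A ⊗ B`-factorisation. -/
abbrev inL (f : Arrow C) : Arrow.mk (B.lam f) ⟶ Arrow.mk ((tensorFact A B).lam f) :=
  Arrow.homMk (𝟙 f.left) (A.lam (Arrow.mk (B.rho f)))

/-- The morphism of arrows `(B.E(1, λ^A_{R f}) · σ^B_f, 1)`, whose image under `A.E` enters into the
comultiplication of `A ⊗ B`. -/
abbrev midMap (f : Arrow C) :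
    Arrow.mk (A.lam (Arrow.mk (B.rho f))) ⟶
      Arrow.mk (B.rho (Arrow.mk ((tensorFact A B).lam f))) :=
  Arrow.homMk (B.sigma f ≫ B.E.map (inL A B f)) (𝟙 _) (by
    simp [B.rho_nat, reassoc_of% B.sigma_rho])

abbrev tensorSigma (f : Arrow C) :
    (tensorFact A B).E.obj f ⟶ (tensorFact A B).E.obj (Arrow.mk ((tensorFact A B).lam f)) :=
  A.sigma (Arrow.mk (B.rho f)) ≫ A.E.map (midMap A B f)

theorem inL_nat {f g : Arrow C} (s : f ⟶ g) :
    B.L.map s ≫ inL A B g = inL A B f ≫ (tensorFact A B).L.map s := by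
  ext
  · simp
  · simpa using (A.lam_nat (B.R.map s)).symm

theorem midMap_nat {f g : Arrow C} (s : f ⟶ g) :
    A.L.map (B.R.map s) ≫ midMap A B g =
      midMap A B f ≫ B.R.map ((tensorFact A B).L.map s) := by
  ext
  · have := congrArg B.E.map (inL_nat A B s)
    simp only [Functor.map_comp] at this
    simp only [Arrow.comp_left, Arrow.homMk_left, Category.assoc]
    rw [← this, reassoc_of% B.sigma_nat s]
  · simp

theorem lam_inL (f : Arrow C) :
    B.lam (Arrow.mk (B.lam f)) ≫ B.E.map (inL A B f) =
      B.lam (Arrow.mk ((tensorFact A B).lam f)) :=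
  (B.lam_nat (inL A B f)).trans (Category.id_comp _)

theorem lam_midMap (f : Arrow C) :
    A.lam (Arrow.mk (A.lam (Arrow.mk (B.rho f)))) ≫ A.E.map (midMap A B f) =
      B.sigma f ≫ B.E.map (inL A B f) ≫
        A.lam (Arrow.mk (B.rho (Arrow.mk ((tensorFact A B).lam f)))) :=
  (A.lam_nat (midMap A B f)).trans (Category.assoc _ _ _)

theorem lam_tensorSigma (f : Arrow C) :
    (tensorFact A B).lam f ≫ tensorSigma A B f =
      (tensorFact A B).lam (Arrow.mk ((tensorFact A B).lam f)) := by
  simp only [Category.assoc, reassoc_of% A.lam_sigma, lam_midMap, reassoc_of% B.lam_sigma,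
    reassoc_of% lam_inL]

/-- `(1, σ_f)` for the composite factorisation. -/
abbrev tensorSig (f : Arrow C) :
    Arrow.mk ((tensorFact A B).lam f) ⟶
      Arrow.mk ((tensorFact A B).lam (Arrow.mk ((tensorFact A B).lam f))) :=
  Arrow.homMk (𝟙 f.left) (tensorSigma A B f)
    ((Category.id_comp _).trans (lam_tensorSigma A B f).symm)

theorem tensor_nat {f g : Arrow C} (s : f ⟶ g) :
    (tensorFact A B).E.map s ≫ tensorSigma A B g =
      tensorSigma A B f ≫ (tensorFact A B).E.map ((tensorFact A B).L.map s) := by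
  have h := congrArg A.E.map (midMap_nat A B s)
  simp only [Functor.map_comp] at h
  have h2 := A.sigma_nat (B.R.map s)
  dsimp only [tensorSigma, Functor.comp_map]
  rw [reassoc_of% h2, h, Category.assoc]
  rfl

theorem sig_inL_inL (f : Arrow C) :
    inL A B f ≫ tensorSig A B f =
      B.Sig f ≫ B.L.map (inL A B f) ≫ inL A B (Arrow.mk ((tensorFact A B).lam f)) := by
  ext
  · simp
  · simp only [Arrow.comp_right, Arrow.homMk_right, reassoc_of% A.lam_sigma, lam_midMap]

theorem tensor_coassoc_aux (f : Arrow C) :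
    midMap A B f ≫ B.R.map (tensorSig A B f) =
      A.Sig (Arrow.mk (B.rho f)) ≫ A.L.map (midMap A B f) ≫
        midMap A B (Arrow.mk ((tensorFact A B).lam f)) := by
  ext
  · have h := congrArg B.E.map (sig_inL_inL A B f)
    simp only [Functor.map_comp] at h
    have h2 := B.sigma_nat (inL A B f)
    simp only [Arrow.comp_left, Arrow.homMk_left, Category.assoc]
    rw [h, reassoc_of% B.coassoc', reassoc_of% h2]
    exact (Category.id_comp _).symm
  · simp

/-- The tensor product `A ⊗ B` of comonads over `dom`. Its comultiplication at `f` is the composite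
of `σ^A_{R f}` with the image under `A.E` of the morphism of arrows
`(B.E(1, λ^A_{R f}) · σ^B_f, 1)`. -/
abbrev tensor : DomComonad C where
  toFunFact := tensorFact A B
  sigma := tensorSigma A B
  lam_sigma := lam_tensorSigma A B
  sigma_nat := tensor_nat A B
  sigma_rho f := by
    have h := A.rho_nat (midMap A B f)
    simp only [Arrow.homMk_right] at h
    dsimp only [tensorSigma]
    rw [Category.assoc, h]
    exact (Category.assoc _ _ _).symm.trans ((Category.comp_id _).trans (A.sigma_rho _))
  sigma_Phi f := by
    have h : midMap A B f ≫ B.R.map ((tensorFact A B).Phi f) = A.Phi (Arrow.mk (B.rho f)) := by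
      have h1 : inL A B f ≫ (tensorFact A B).Phi f = B.Phi f := by ext <;> simp
      have h2 := congrArg B.E.map h1
      rw [Functor.map_comp] at h2
      ext
      · simp only [Arrow.comp_left, Arrow.homMk_left, Category.assoc]
        rw [h2, B.sigma_Phi]; rfl
      · simp
    have h2 := congrArg A.E.map h
    rw [Functor.map_comp] at h2
    dsimp only [tensorSigma, Functor.comp_map]
    rw [Category.assoc, h2, A.sigma_Phi]; rfl
  coassoc f := by
    have h2 := congrArg A.E.map (tensor_coassoc_aux A B f)
    simp only [Functor.map_comp] at h2
    have h3 := A.sigma_nat (midMap A B f)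
    change (A.sigma _ ≫ A.E.map _) ≫ A.E.map (B.R.map (tensorSig A B f)) =
      (A.sigma _ ≫ A.E.map _) ≫ A.sigma _ ≫ A.E.map _
    rw [Category.assoc, h2, reassoc_of% A.coassoc', Category.assoc, reassoc_of% h3]

end Tensor

section Map

variable {A A' B B' : DomComonad C} (a : A ⟶ A') (b : B ⟶ B')

/-- The components of `a ⊗ b`: `(a ⊗ b)_f = a_{R' f} · A.E(b_f, 1)`. -/
abbrev tensorApp (f : Arrow C) : (tensor A B).E.obj f ⟶ (tensor A' B').E.obj f :=
  A.E.map (Hom.mapR b f) ≫ Hom.app a (Arrow.mk (B'.rho f))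

theorem lam_tensorApp (f : Arrow C) :
    (tensor A B).lam f ≫ tensorApp a b f = (tensor A' B').lam f := by
  have h := A.lam_nat (Hom.mapR b f)
  simp only [Arrow.homMk_left] at h
  simp only [Category.assoc, reassoc_of% h, Hom.lam, reassoc_of% (Hom.lam b)]

/-- `(1, (a ⊗ b)_f)`. -/
abbrev tensorMapL (f : Arrow C) :
    Arrow.mk ((tensor A B).lam f) ⟶ Arrow.mk ((tensor A' B').lam f) :=
  Arrow.homMk (𝟙 f.left) (tensorApp a b f)
    ((Category.id_comp _).trans (lam_tensorApp a b f).symm)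

theorem tensorMap_aux₁ (f : Arrow C) :
    Hom.mapL b f ≫ inL A' B' f = inL A B f ≫ tensorMapL a b f := by
  have h := A.lam_nat (Hom.mapR b f)
  simp only [Arrow.homMk_left] at h
  ext
  · simp
  · simp only [Arrow.comp_right, Arrow.homMk_right, reassoc_of% h, Hom.lam]

theorem tensorMap_aux₂ (f : Arrow C) :
    A.L.map (Hom.mapR b f) ≫ Hom.mapL a (Arrow.mk (B'.rho f)) ≫ midMap A' B' f =
      midMap A B f ≫ B.R.map (tensorMapL a b f) ≫
        Hom.mapR b (Arrow.mk ((tensor A' B').lam f)) := by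
  have h := congrArg B.E.map (tensorMap_aux₁ a b f)
  simp only [Functor.map_comp] at h
  ext
  · simp only [Arrow.comp_left, Arrow.homMk_left, Category.assoc]
    have h2 := Hom.nat b (inL A' B' f)
    have h3 := Hom.sigma' b f
    refine Eq.trans (congrArg (Hom.app b f ≫ ·) (Category.id_comp _)) ?_
    rw [reassoc_of% h3, ← h2, reassoc_of% h]
  · simp

/-- The functoriality of the tensor product. -/
def tensorMap : tensor A B ⟶ tensor A' B' where
  app f := tensorApp a b f
  nat {f g} s := by
    have h : B.R.map s ≫ Hom.mapR b g = Hom.mapR b f ≫ B'.R.map s := by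
      ext
      · simpa using Hom.nat b s
      · simp
    have h2 := congrArg A.E.map h
    simp only [Functor.map_comp] at h2
    have h3 := Hom.nat a (B'.R.map s)
    dsimp only [Functor.comp_map]
    rw [reassoc_of% h2, h3, Category.assoc]
  lam f := lam_tensorApp a b f
  rho f := by
    have h := A.rho_nat (Hom.mapR b f)
    simp only [Category.assoc, Hom.rho, h]
    exact Category.comp_id _
  sigma f := by
    have h := congrArg A.E.map (tensorMap_aux₂ a b f)
    simp only [Functor.map_comp] at h
    have h1 := A.sigma_nat (Hom.mapR b f)
    have h2 := Hom.sigma' a (Arrow.mk (B'.rho f))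
    have h3 := Hom.nat a (midMap A' B' f)
    change (A.E.map _ ≫ Hom.app a _) ≫ A'.sigma _ ≫ A'.E.map (midMap A' B' f) =
      (A.sigma _ ≫ A.E.map (midMap A B f)) ≫ A.E.map (B.R.map (tensorMapL a b f)) ≫
        A.E.map (Hom.mapR b _) ≫ Hom.app a _
    simp only [Category.assoc]
    rw [reassoc_of% h2, ← h3, reassoc_of% h1, reassoc_of% h]

end Map

/-- A morphism all of whose components are invertible is invertible. -/
def isoOfComponents {A B : DomComonad C} (a : A ⟶ B) (b : ∀ f, B.E.obj f ⟶ A.E.obj f)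
    (h₁ : ∀ f, Hom.app a f ≫ b f = 𝟙 _) (h₂ : ∀ f, b f ≫ Hom.app a f = 𝟙 _) : A ≅ B where
  hom := a
  inv :=
    have hl (f : Arrow C) : B.lam f ≫ b f = A.lam f := by
      rw [← Hom.lam a, Category.assoc, h₁, Category.comp_id]
    have hn {f g : Arrow C} (s : f ⟶ g) : B.E.map s ≫ b g = b f ≫ A.E.map s := by
      have h := Hom.nat a s
      rw [← Category.id_comp (B.E.map s), ← h₂ f, Category.assoc, Category.assoc,
        ← reassoc_of% h, h₁, Category.comp_id]
    { app := b
      nat := hn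
      lam := hl
      rho := fun f => by rw [← Hom.rho a, ← Category.assoc, h₂, Category.id_comp]
      sigma := fun f => by
        let e : Arrow.mk (B.lam f) ⟶ Arrow.mk (A.lam f) :=
          Arrow.homMk (𝟙 f.left) (b f) ((Category.id_comp _).trans (hl f).symm)
        change b f ≫ A.sigma f = B.sigma f ≫ B.E.map e ≫ b _
        have h := Hom.sigma' a f
        have he : Hom.mapL a f ≫ e = 𝟙 _ := by
          ext
          · exact Category.id_comp _
          · exact h₁ f
        have he' := congrArg A.E.map he
        rw [Functor.map_comp, CategoryTheory.Functor.map_id] at he'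
        have h3 := Hom.nat a e
        rw [← Category.id_comp (B.sigma f), ← h₂ f, Category.assoc, Category.assoc, reassoc_of% h,
          ← reassoc_of% h3, h₁, Category.comp_id, he', Category.comp_id] }
  hom_inv_id := hom_ext h₁
  inv_hom_id := hom_ext h₂

theorem assoc_aux (A B D : DomComonad C) (f : Arrow C)
    (e : Arrow.mk ((tensor (tensor A B) D).lam f) ⟶ Arrow.mk ((tensor A (tensor B D)).lam f))
    (h₁ : e.left = 𝟙 _) (h₂ : e.right = 𝟙 _) :
    midMap A (tensor B D) f =
      midMap A B (Arrow.mk (D.rho f)) ≫ B.R.map (midMap (tensor A B) D f) ≫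
        B.R.map (D.R.map e) := by
  have k₁ : inL B D f ≫ inL A (tensor B D) f = inL (tensor A B) D f ≫ e := by
    ext
    · simp [h₁]
    · simp only [Arrow.comp_right, Arrow.homMk_right, h₂]
      exact (Category.comp_id _).symm
  have k₁' := congrArg D.E.map k₁
  simp only [Functor.map_comp] at k₁'
  have k₂ : midMap B D f ≫ D.R.map (inL A (tensor B D) f) =
      inL A B (Arrow.mk (D.rho f)) ≫ midMap (tensor A B) D f ≫ D.R.map e := by
    ext
    · simp only [Arrow.comp_left, Arrow.homMk_left, Category.assoc]
      rw [k₁']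
      exact (Category.id_comp _).symm
    · simp only [Arrow.comp_right, Arrow.homMk_right, h₂]
      exact (Category.id_comp _).trans
        ((congrArg _ (Category.id_comp _)).trans (Category.comp_id _)).symm
  have k₂' := congrArg B.E.map k₂
  simp only [Functor.map_comp] at k₂'
  ext
  · simp only [Arrow.comp_left, Arrow.homMk_left, Category.assoc]
    exact congrArg (B.sigma _ ≫ ·) k₂'
  · simp only [Arrow.comp_right, Arrow.homMk_right, h₂]
    exact ((Category.id_comp _).trans (Category.id_comp _)).symm

/-- The associator; its components are identities. -/
def assocIso (A B D : DomComonad C) : tensor (tensor A B) D ≅ tensor A (tensor B D) :=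
  isoOfComponents
    { app := fun f => 𝟙 _
      nat := fun s => (Category.comp_id _).trans (Category.id_comp _).symm
      lam := fun f => (Category.comp_id _).trans
        (Category.assoc (D.lam f) (B.lam (Arrow.mk (D.rho f)))
          (A.lam (Arrow.mk (B.rho (Arrow.mk (D.rho f)))))).symm
      rho := fun f => Category.id_comp _
      sigma := fun f => by
        refine (Category.id_comp _).trans (Eq.trans ?_ (congrArg _ (Category.comp_id _).symm))
        have h := congrArg A.E.map (assoc_aux A B D f (Arrow.homMk (𝟙 _) (𝟙 _)
          ((Category.id_comp _).trans ((Category.assoc (D.lam f) (B.lam (Arrow.mk (D.rho f)))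
            (A.lam (Arrow.mk (B.rho (Arrow.mk (D.rho f)))))).trans (Category.comp_id _).symm))) rfl rfl)
        simp only [Functor.map_comp] at h
        refine (congrArg (A.sigma _ ≫ ·) h).trans ?_
        exact (Category.assoc _ _ _).symm.trans (Category.assoc _ _ _).symm }
    (fun f => 𝟙 _) (fun f => Category.id_comp _) (fun f => Category.id_comp _)

theorem map_homMk_id {D : Type*} [Category* D] (G : Arrow C ⥤ D) {X Y : C} (h : X ⟶ Y)
    (w : 𝟙 X ≫ (Arrow.mk h).hom = (Arrow.mk h).hom ≫ 𝟙 Y) :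
    G.map (Arrow.homMk (𝟙 X) (𝟙 Y) w : Arrow.mk h ⟶ Arrow.mk h) = 𝟙 _ :=
  G.map_id (Arrow.mk h)

/-- The left unitor; its components are identities. -/
def leftUnitorIso (A : DomComonad C) : tensor (unitObj C) A ≅ A :=
  isoOfComponents
    { app := fun f => 𝟙 _
      nat := fun s => (Category.comp_id _).trans (Category.id_comp _).symm
      lam := fun f => (Category.comp_id _).trans (Category.comp_id _)
      rho := fun f => Category.id_comp _
      sigma := fun f => by
        let e : Arrow.mk ((tensor (unitObj C) A).lam f) ⟶ Arrow.mk (A.lam f) :=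
          Arrow.homMk (𝟙 f.left) (𝟙 (A.E.obj f))
            ((Category.id_comp _).trans ((Category.comp_id _).trans (Category.comp_id _)).symm)
        change 𝟙 _ ≫ A.sigma f = (𝟙 _ ≫ A.sigma f ≫ A.E.map (inL (unitObj C) A f)) ≫
          A.E.map e ≫ 𝟙 _
        have h : inL (unitObj C) A f ≫ e = 𝟙 _ := by
          ext
          · exact Category.id_comp _
          · exact Category.id_comp _
        have h' := congrArg A.E.map h
        rw [Functor.map_comp, CategoryTheory.Functor.map_id] at h'
        simp only [Category.id_comp, Category.comp_id, Category.assoc, h'] }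
    (fun f => 𝟙 _) (fun f => Category.id_comp _) (fun f => Category.id_comp _)

/-- The right unitor; its components are identities. -/
def rightUnitorIso (A : DomComonad C) : tensor A (unitObj C) ≅ A :=
  isoOfComponents
    { app := fun f => 𝟙 _
      nat := fun s => (Category.comp_id _).trans (Category.id_comp _).symm
      lam := fun f => (Category.comp_id _).trans (Category.id_comp _)
      rho := fun f => Category.id_comp _
      sigma := fun f => by
        let e : Arrow.mk ((tensor A (unitObj C)).lam f) ⟶ Arrow.mk (A.lam f) :=
          Arrow.homMk (𝟙 f.left) (𝟙 (A.E.obj f))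
            ((Category.id_comp _).trans ((Category.comp_id _).trans (Category.id_comp _)).symm)
        change 𝟙 _ ≫ A.sigma f = (A.sigma f ≫ A.E.map (midMap A (unitObj C) f)) ≫
          A.E.map ((unitObj C).R.map e) ≫ 𝟙 _
        have h : midMap A (unitObj C) f ≫ (unitObj C).R.map e = 𝟙 _ := by
          ext
          · exact (congrArg (· ≫ _) (Category.id_comp _)).trans (Category.id_comp _)
          · exact Category.id_comp _
        have h' : A.E.map (midMap A (unitObj C) f) ≫ A.E.map ((unitObj C).R.map e) = 𝟙 _ :=
          (A.E.map_comp _ _).symm.trans ((congrArg A.E.map h).trans (A.E.map_id _))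
        simp only [Category.id_comp, Category.comp_id, Category.assoc]
        exact ((congrArg (A.sigma _ ≫ ·) h').trans (Category.comp_id _)).symm }
    (fun f => 𝟙 _) (fun f => Category.id_comp _) (fun f => Category.id_comp _)

theorem tensorMap_comp {A₁ A₂ A₃ B₁ B₂ B₃ : DomComonad C} (a : A₁ ⟶ A₂) (b : B₁ ⟶ B₂)
    (a' : A₂ ⟶ A₃) (b' : B₂ ⟶ B₃) :
    tensorMap a b ≫ tensorMap a' b' = tensorMap (a ≫ a') (b ≫ b') := by
  apply hom_ext
  intro f
  change (A₁.E.map (Hom.mapR b f) ≫ Hom.app a _) ≫ A₂.E.map (Hom.mapR b' f) ≫ Hom.app a' _ =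
    A₁.E.map (Hom.mapR (b ≫ b') f) ≫ Hom.app a _ ≫ Hom.app a' _
  have h : Hom.mapR (b ≫ b') f = Hom.mapR b f ≫ Hom.mapR b' f := by
    ext
    · rfl
    · exact (Category.id_comp _).symm
  have h2 := Hom.nat a (Hom.mapR b' f)
  rw [h, Functor.map_comp, Category.assoc, Category.assoc, reassoc_of% h2]

theorem tensorMap_assoc {A A' B B' D D' : DomComonad C} (a : A ⟶ A') (b : B ⟶ B') (d : D ⟶ D') :
    tensorMap (tensorMap a b) d ≫ (assocIso A' B' D').hom =
      (assocIso A B D).hom ≫ tensorMap a (tensorMap b d) := by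
  apply hom_ext
  intro f
  refine (Category.comp_id _).trans (Eq.trans ?_ (Category.id_comp _).symm)
  change A.E.map (B.R.map (Hom.mapR d f)) ≫ A.E.map (Hom.mapR b _) ≫ Hom.app a _ =
    A.E.map (Hom.mapR (tensorMap b d) f) ≫ Hom.app a _
  have h : Hom.mapR (tensorMap b d) f = B.R.map (Hom.mapR d f) ≫ Hom.mapR b _ := by
    ext
    · rfl
    · exact (Category.id_comp _).symm
  rw [h, Functor.map_comp, Category.assoc]

instance : MonoidalCategory (DomComonad C) :=
  letI : MonoidalCategoryStruct (DomComonad C) :=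
    { tensorObj := tensor
      tensorHom := tensorMap
      whiskerLeft := fun A _ _ b => tensorMap (𝟙 A) b
      whiskerRight := fun a B => tensorMap a (𝟙 B)
      tensorUnit := unitObj C
      associator := assocIso
      leftUnitor := leftUnitorIso
      rightUnitor := rightUnitorIso }
  MonoidalCategory.ofTensorHom
    (id_tensorHom_id := fun A B => hom_ext fun f =>
      (Category.comp_id _).trans (map_homMk_id A.E _ _))
    (id_tensorHom := fun _ _ _ _ => rfl)
    (tensorHom_id := fun _ _ => rfl)
    (tensorHom_comp_tensorHom := fun a b a' b' => tensorMap_comp a b a' b')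
    (associator_naturality := fun a b d => tensorMap_assoc a b d)
    (leftUnitor_naturality := fun b => hom_ext fun f =>
      (Category.comp_id _).trans ((Category.comp_id _).trans (Category.id_comp _).symm))
    (rightUnitor_naturality := fun {A B} a => hom_ext fun f =>
      (Category.comp_id _).trans ((congrArg (· ≫ _) (map_homMk_id A.E _ _))))
    (pentagon := fun W X Y Z => hom_ext fun f => by
      have h₁ : Hom.app (tensorMap (assocIso W X Y).hom (𝟙 Z)) f = 𝟙 _ :=
        (Category.comp_id _).trans (map_homMk_id (tensor (tensor W X) Y).E _ _)
      have h₂ : Hom.app (tensorMap (𝟙 W) (assocIso X Y Z).hom) f = 𝟙 _ :=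
        (Category.comp_id _).trans (map_homMk_id W.E _ _)
      exact (congrArg₂ (· ≫ ·) h₁ (congrArg₂ (· ≫ ·) rfl h₂)).trans (Category.id_comp _))
    (triangle := fun A B => hom_ext fun f => by
      have h₁ : Hom.app (tensorMap (𝟙 A) (leftUnitorIso B).hom) f = 𝟙 _ :=
        (Category.comp_id _).trans (map_homMk_id A.E _ _)
      have h₂ : Hom.app (tensorMap (rightUnitorIso A).hom (𝟙 B)) f = 𝟙 _ :=
        (Category.comp_id _).trans (map_homMk_id (tensor A (unitObj C)).E _ _)
      exact (congrArg₂ (· ≫ ·) rfl h₁).trans ((Category.id_comp _).trans h₂.symm))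

end DomComonad

/-- An `L`-map structure on the arrow `f : X ⟶ Y`: a map `s : Y ⟶ E f` such that `(1, s)` is a
coalgebra structure on `f` for the comonad `L`. -/
structure LMapStructure {C : Type u} [Category.{v} C] (A : DomComonad C) (f : Arrow C) where
  s : f.right ⟶ A.E.obj f
  hom_s : f.hom ≫ s = A.lam f
  s_rho : s ≫ A.rho f = 𝟙 f.right
  s_sigma : s ≫ A.sigma f =
    s ≫ A.E.map (Arrow.homMk (𝟙 f.left) s ((Category.id_comp _).trans hom_s.symm) :
      f ⟶ Arrow.mk (A.lam f))

namespace LMapStructure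

variable {C : Type u} [Category.{v} C] {A B : DomComonad C} {f : Arrow C}

/-- The corresponding coalgebra for the comonad `L`. -/
def toCoalgebra (t : LMapStructure A f) : A.comonad.Coalgebra where
  A := f
  a := Arrow.homMk (𝟙 f.left) t.s ((Category.id_comp _).trans t.hom_s.symm)
  counit := by
    ext
    · exact Category.id_comp _
    · exact t.s_rho
  coassoc := by
    ext
    · rfl
    · exact t.s_sigma

/-- The action on `L`-maps of a morphism of comonads over `dom`. -/
def map (a : A ⟶ B) (t : LMapStructure A f) : LMapStructure B f where
  s := t.s ≫ DomComonad.Hom.app a f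
  hom_s := by rw [← Category.assoc, t.hom_s, DomComonad.Hom.lam]
  s_rho := by rw [Category.assoc, DomComonad.Hom.rho, t.s_rho]
  s_sigma := by
    let e : f ⟶ Arrow.mk (A.lam f) :=
      Arrow.homMk (𝟙 f.left) t.s ((Category.id_comp _).trans t.hom_s.symm)
    let e' : f ⟶ Arrow.mk (B.lam f) :=
      Arrow.homMk (𝟙 f.left) (t.s ≫ DomComonad.Hom.app a f) ((Category.id_comp _).trans
        (by rw [← Category.assoc, t.hom_s, DomComonad.Hom.lam]; rfl))
    have he : e ≫ DomComonad.Hom.mapL a f = e' := by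
      ext
      · exact Category.id_comp _
      · rfl
    have h := t.s_sigma
    change t.s ≫ A.sigma f = t.s ≫ A.E.map e at h
    change (t.s ≫ DomComonad.Hom.app a f) ≫ B.sigma f =
      (t.s ≫ DomComonad.Hom.app a f) ≫ B.E.map e'
    rw [Category.assoc, DomComonad.Hom.sigma' a f, Category.assoc,
      ← DomComonad.Hom.nat a e', reassoc_of% h, ← Functor.map_comp_assoc, he]

end LMapStructure

/-- The set `S_g` of lifting problems from members of the family `J` to `g`. -/
abbrev Squares {C : Type u} [Category.{v} C] {ι : Type v} (J : ι → Arrow C) (g : Arrow C) :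
    Type v :=
  Σ i : ι, (J i ⟶ g)

/-! ### The one-step comonad -/

namespace OneStep

variable {C : Type u} [Category.{v} C] [HasColimits C] {ι : Type v} (J : ι → Arrow C)

/-- `⟨h_x⟩ : ∑ A_x ⟶ C`. -/
noncomputable abbrev top (g : Arrow C) : (∐ fun x : Squares J g => (J x.1).left) ⟶ g.left :=
  Sigma.desc fun x => x.2.left

/-- `∑ f_x : ∑ A_x ⟶ ∑ B_x`. -/
noncomputable abbrev K (g : Arrow C) :
    (∐ fun x : Squares J g => (J x.1).left) ⟶ ∐ fun x : Squares J g => (J x.1).right :=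
  Limits.Sigma.map fun x => (J x.1).hom

/-- The object `E¹ g`: the pushout of `∑ f_x` along `⟨h_x⟩`. -/
noncomputable abbrev obj (g : Arrow C) : C := pushout (top J g) (K J g)

noncomputable def lam (g : Arrow C) : g.left ⟶ obj J g := pushout.inl _ _

/-- The composite `B_x ⟶ ∑ B_x ⟶ E¹ g`. -/
noncomputable def cell {g : Arrow C} (x : Squares J g) : (J x.1).right ⟶ obj J g :=
  Sigma.ι (fun x : Squares J g => (J x.1).right) x ≫ pushout.inr (top J g) (K J g)

theorem cell_comm {g : Arrow C} (x : Squares J g) :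
    (J x.1).hom ≫ cell J x = x.2.left ≫ lam J g := by
  have h := Sigma.ι (fun x : Squares J g => (J x.1).left) x ≫= pushout.condition (f := top J g)
    (g := K J g)
  simp only [top, K, colimit.ι_desc_assoc, Limits.Sigma.ι_map_assoc, Cofan.mk_ι_app] at h
  exact h.symm

/-- The universal property of `E¹ g`. -/
noncomputable def desc {g : Arrow C} {Z : C} (u : g.left ⟶ Z)
    (k : ∀ x : Squares J g, (J x.1).right ⟶ Z)
    (w : ∀ x, (J x.1).hom ≫ k x = x.2.left ≫ u) : obj J g ⟶ Z :=
  pushout.desc u (Sigma.desc k) (by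
    apply Sigma.hom_ext
    intro x
    simp [w])

@[simp] theorem lam_desc {g : Arrow C} {Z : C} (u : g.left ⟶ Z)
    (k : ∀ x : Squares J g, (J x.1).right ⟶ Z) (w : ∀ x, (J x.1).hom ≫ k x = x.2.left ≫ u) :
    lam J g ≫ desc J u k w = u := pushout.inl_desc _ _ _

@[simp] theorem cell_desc {g : Arrow C} {Z : C} (u : g.left ⟶ Z)
    (k : ∀ x : Squares J g, (J x.1).right ⟶ Z) (w : ∀ x, (J x.1).hom ≫ k x = x.2.left ≫ u)
    (x : Squares J g) : cell J x ≫ desc J u k w = k x := by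
  unfold cell desc
  rw [Category.assoc, pushout.inr_desc]
  exact Sigma.ι_desc _ _

theorem hom_ext {g : Arrow C} {Z : C} {a b : obj J g ⟶ Z} (h₁ : lam J g ≫ a = lam J g ≫ b)
    (h₂ : ∀ x : Squares J g, cell J x ≫ a = cell J x ≫ b) : a = b := by
  apply pushout.hom_ext h₁
  apply Sigma.hom_ext
  intro x
  have := h₂ x
  simp only [cell, Category.assoc] at this
  exact this

/-- The action of `E¹` on morphisms: it sends the cell of `x` to the cell of `S_γ(x) = x ≫ γ`. -/
noncomputable def map {g g' : Arrow C} (s : g ⟶ g') : obj J g ⟶ obj J g' :=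
  desc J (s.left ≫ lam J g') (fun x => cell J (⟨x.1, x.2 ≫ s⟩ : Squares J g'))
    (fun x => (cell_comm J (⟨x.1, x.2 ≫ s⟩ : Squares J g')).trans (Category.assoc _ _ _))

@[simp] theorem lam_map {g g' : Arrow C} (s : g ⟶ g') :
    lam J g ≫ map J s = s.left ≫ lam J g' := lam_desc _ _ _ _

@[simp] theorem cell_map {g g' : Arrow C} (s : g ⟶ g') (x : Squares J g) :
    cell J x ≫ map J s = cell J (⟨x.1, x.2 ≫ s⟩ : Squares J g') := cell_desc _ _ _ _ _

theorem cell_map' {g g' : Arrow C} (s : g ⟶ g') (x : Squares J g) (t : J x.1 ⟶ g')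
    (h : x.2 ≫ s = t) : cell J x ≫ map J s = cell J (⟨x.1, t⟩ : Squares J g') := by
  subst h; exact cell_map J s x

noncomputable def rho (g : Arrow C) : obj J g ⟶ g.right :=
  desc J g.hom (fun x => x.2.right) (fun x => x.2.w.symm)

@[simp] theorem lam_rho (g : Arrow C) : lam J g ≫ rho J g = g.hom := lam_desc _ _ _ _

@[simp] theorem cell_rho {g : Arrow C} (x : Squares J g) : cell J x ≫ rho J g = x.2.right :=
  cell_desc _ _ _ _ _

/-- The one-step functorial factorisation `(E¹, λ¹, ρ¹)`. -/
noncomputable abbrev fact : FunFact C where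
  E :=
    { obj := obj J
      map := map J
      map_id := fun g => hom_ext J (by simp) (fun x =>
        (cell_map' J (𝟙 g) x x.2 (Category.comp_id _)).trans (Category.comp_id _).symm)
      map_comp := fun s t => hom_ext J (by
          simp [reassoc_of% (lam_map J)]) (fun x => by
        refine (cell_map' J (s ≫ t) x ((x.2 ≫ s) ≫ t) (Category.assoc _ _ _).symm).trans ?_
        rw [← Category.assoc, cell_map, cell_map]) }
  lam := lam J
  rho := rho J
  lam_nat s := by simp
  rho_nat s := hom_ext J (by
    simp [reassoc_of% (lam_map J), reassoc_of% (lam_rho J)]) (fun x => by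
    rw [← Category.assoc, ← Category.assoc]
    simp)
  fac := lam_rho J

/-- `ψ_g : S_g ⟶ S_{L¹ g}`, sending `x` to `f_x ⟶ K g ⟶ L¹ g`. -/
noncomputable abbrev psi {g : Arrow C} (x : Squares J g) : Squares J (Arrow.mk (lam J g)) :=
  ⟨x.1, Arrow.homMk x.2.left (cell J x) (cell_comm J x).symm⟩

noncomputable def sigma (g : Arrow C) : obj J g ⟶ obj J (Arrow.mk (lam J g)) :=
  desc J (lam J (Arrow.mk (lam J g))) (fun x => cell J (psi J x))
    (fun x => cell_comm J (psi J x))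

@[simp] theorem lam_sigma (g : Arrow C) :
    lam J g ≫ sigma J g = lam J (Arrow.mk (lam J g)) := lam_desc _ _ _ _

@[simp] theorem cell_sigma {g : Arrow C} (x : Squares J g) :
    cell J x ≫ sigma J g = cell J (psi J x) := cell_desc _ _ _ _ _

/-- The one-step comonad `L¹` of `J`. -/
noncomputable def comonad : DomComonad C where
  toFunFact := fact J
  sigma := sigma J
  lam_sigma := lam_sigma J
  sigma_nat {f g} s := hom_ext J (by
      change lam J f ≫ map J s ≫ sigma J g = lam J f ≫ sigma J f ≫ map J _
      rw [← Category.assoc, lam_map, ← Category.assoc, lam_sigma, lam_map, Category.assoc,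
        lam_sigma]; rfl) (fun x => by
    change cell J x ≫ map J s ≫ sigma J g = cell J x ≫ sigma J f ≫ map J _
    rw [← Category.assoc, cell_map, ← Category.assoc, cell_sigma, cell_sigma]
    refine (cell_map' J _ (psi J x) (psi J (⟨x.1, x.2 ≫ s⟩ : Squares J g)).2 ?_).symm
    ext
    · rfl
    · exact cell_map J s x)
  sigma_rho f := hom_ext J (by
      change lam J f ≫ sigma J f ≫ rho J _ = _
      rw [← Category.assoc, lam_sigma, lam_rho]
      exact (Category.comp_id _).symm) (fun x => by
    change cell J x ≫ sigma J f ≫ rho J _ = _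
    rw [← Category.assoc, cell_sigma, cell_rho]
    exact (Category.comp_id _).symm)
  sigma_Phi f := hom_ext J (by
      change lam J f ≫ sigma J f ≫ map J _ = _
      rw [← Category.assoc, lam_sigma, lam_map]
      exact (Category.id_comp _).trans (Category.comp_id _).symm) (fun x => by
    change cell J x ≫ sigma J f ≫ map J _ = _
    rw [← Category.assoc, cell_sigma]
    refine (cell_map' J _ (psi J x) x.2 ?_).trans (Category.comp_id _).symm
    ext
    · exact Category.comp_id _
    · exact cell_rho J x)
  coassoc f := hom_ext J (by
      change lam J f ≫ sigma J f ≫ map J _ = lam J f ≫ sigma J f ≫ sigma J _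
      rw [← Category.assoc, lam_sigma, lam_map, ← Category.assoc, lam_sigma, lam_sigma]
      exact Category.id_comp _) (fun x => by
    change cell J x ≫ sigma J f ≫ map J _ = cell J x ≫ sigma J f ≫ sigma J _
    rw [← Category.assoc, cell_sigma, ← Category.assoc, cell_sigma, cell_sigma]
    refine cell_map' J _ _ _ ?_
    ext
    · exact Category.comp_id _
    · exact cell_sigma J x)

/-- The canonical `L¹`-map structure on a member `f` of `J`: the codomain part of
`f ⟶ K f ⟶ L¹ f`, where the first map is the injection at `id_f ∈ S_f`. -/
noncomputable def canonical (i : ι) : LMapStructure (comonad J) (J i) where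
  s := cell J (⟨i, 𝟙 (J i)⟩ : Squares J (J i))
  hom_s := (cell_comm J (⟨i, 𝟙 (J i)⟩ : Squares J (J i))).trans (Category.id_comp _)
  s_rho := cell_rho J (⟨i, 𝟙 (J i)⟩ : Squares J (J i))
  s_sigma := by
    refine (cell_sigma J (⟨i, 𝟙 (J i)⟩ : Squares J (J i))).trans
      (cell_map' J _ (⟨i, 𝟙 (J i)⟩ : Squares J (J i))
        (psi J (⟨i, 𝟙 (J i)⟩ : Squares J (J i))).2 ?_).symm
    ext
    · exact Category.id_comp _
    · exact Category.id_comp _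

end OneStep

/-! ### Natural weak factorisation systems -/

/-- A natural weak factorisation system, in reduced form `(E, λ, ρ, σ, π)`: to the comonad
`L = (L, Φ, Σ)` over `dom` it adds the components `π_f : E R f ⟶ E f` of the multiplication of
the monad `R = (R, Λ, Π)`, subject to the monad axioms and to the remaining axiom `distrib` for
the distributive law `Δ_f = (σ_f, π_f) : L R f ⟶ R L f`. -/
structure NWFS (C : Type u) [Category.{v} C] extends DomComonad C where
  pi (f : Arrow C) : E.obj (Arrow.mk (rho f)) ⟶ E.obj f
  pi_nat {f g : Arrow C} (s : f ⟶ g) : E.map (toFunFact.R.map s) ≫ pi g = pi f ≫ E.map s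
  pi_rho (f : Arrow C) : pi f ≫ rho f = rho (Arrow.mk (rho f))
  lam_pi (f : Arrow C) : lam (Arrow.mk (rho f)) ≫ pi f = 𝟙 (E.obj f)
  Lambda_pi (f : Arrow C) : E.map (toFunFact.Lambda f) ≫ pi f = 𝟙 (E.obj f)
  assoc (f : Arrow C) :
    E.map (Arrow.homMk (pi f) (𝟙 f.right) ((pi_rho f).trans (Category.comp_id _).symm) :
      Arrow.mk (rho (Arrow.mk (rho f))) ⟶ Arrow.mk (rho f)) ≫ pi f =
    pi (Arrow.mk (rho f)) ≫ pi f
  distrib (f : Arrow C) :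
    pi f ≫ sigma f = sigma (Arrow.mk (rho f)) ≫
      E.map (Arrow.homMk (sigma f) (pi f) ((sigma_rho f).trans (lam_pi f).symm) :
        Arrow.mk (lam (Arrow.mk (rho f))) ⟶ Arrow.mk (rho (Arrow.mk (lam f)))) ≫
      pi (Arrow.mk (lam f))

namespace NWFS

variable {C : Type u} [Category.{v} C]

/-- The monad `R = (R, Λ, Π)` on the arrow category; its algebras are the `R`-maps. -/
def monad (N : NWFS C) : Monad (Arrow C) where
  toFunctor := N.R
  η := { app := N.Lambda, naturality := fun f g s => by ext <;> simp [N.lam_nat] }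
  μ :=
    { app := fun f => Arrow.homMk (N.pi f) (𝟙 f.right)
        ((N.pi_rho f).trans (Category.comp_id _).symm)
      naturality := fun f g s => by
        ext
        · exact N.pi_nat s
        · exact (Category.comp_id _).trans (Category.id_comp _).symm }
  assoc f := by
    ext
    · exact N.assoc f
    · rfl
  left_unit f := by
    ext
    · exact N.lam_pi f
    · exact Category.id_comp _
  right_unit f := by
    ext
    · exact N.Lambda_pi f
    · exact Category.id_comp _

theorem one_app (U : Mon (DomComonad C)) (f : Arrow C) :
    DomComonad.Hom.app (MonObj.one (X := U.X)) f = U.X.lam f :=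
  (Category.id_comp _).symm.trans (DomComonad.Hom.lam (MonObj.one (X := U.X)) f)

theorem lam_mul (U : Mon (DomComonad C)) (f : Arrow C) :
    U.X.lam (Arrow.mk (U.X.rho f)) ≫ DomComonad.Hom.app (MonObj.mul (X := U.X)) f = 𝟙 _ := by
  have h := congrArg (fun t => DomComonad.Hom.app t f) (MonObj.one_mul U.X)
  have h₁ : DomComonad.Hom.app ((MonObj.one (X := U.X)) ▷ U.X) f =
      U.X.lam (Arrow.mk (U.X.rho f)) := by
    refine Eq.trans (congrArg (· ≫ _) (DomComonad.map_homMk_id _ _ _)) ?_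
    exact (Category.id_comp _).trans (one_app U _)
  exact (congrArg (· ≫ _) h₁).symm.trans h

/-- The natural weak factorisation system corresponding to a monoid in the monoidal category of
comonads over `dom`. -/
def ofMon (U : Mon (DomComonad C)) : NWFS C where
  toDomComonad := U.X
  pi f := DomComonad.Hom.app (MonObj.mul (X := U.X)) f
  pi_nat s := DomComonad.Hom.nat (MonObj.mul (X := U.X)) s
  pi_rho f := DomComonad.Hom.rho (MonObj.mul (X := U.X)) f
  lam_pi f := lam_mul U f
  Lambda_pi f := by
    have h := congrArg (fun t => DomComonad.Hom.app t f) (MonObj.mul_one U.X)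
    have h₁ : DomComonad.Hom.app (U.X ◁ (MonObj.one (X := U.X))) f =
        U.X.E.map (U.X.Lambda f) := by
      refine (Category.comp_id _).trans (congrArg U.X.E.map ?_)
      ext
      · exact one_app U f
      · rfl
    exact (congrArg (· ≫ _) h₁).symm.trans h
  assoc f := by
    have h := congrArg (fun t => DomComonad.Hom.app t f) (MonObj.mul_assoc U.X)
    have h₁ : DomComonad.Hom.app ((MonObj.mul (X := U.X)) ▷ U.X) f =
        DomComonad.Hom.app (MonObj.mul (X := U.X)) (Arrow.mk (U.X.rho f)) :=
      (congrArg (· ≫ _) (DomComonad.map_homMk_id _ _ _)).trans (Category.id_comp _)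
    have h₂ : DomComonad.Hom.app (U.X ◁ (MonObj.mul (X := U.X))) f =
        U.X.E.map (DomComonad.Hom.mapR (MonObj.mul (X := U.X)) f) := Category.comp_id _
    refine ((congrArg (· ≫ _) h₁).symm.trans (h.trans ?_)).symm
    exact (Category.id_comp _).trans (congrArg (· ≫ _) h₂)
  distrib f := by
    have h := DomComonad.Hom.sigma' (MonObj.mul (X := U.X)) f
    refine h.trans ?_
    have k : DomComonad.midMap U.X U.X f ≫
        U.X.R.map (DomComonad.Hom.mapL (MonObj.mul (X := U.X)) f) =
        Arrow.homMk (U.X.sigma f) (DomComonad.Hom.app (MonObj.mul (X := U.X)) f)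
          ((U.X.sigma_rho f).trans (lam_mul U f).symm) := by
      have k₀ : DomComonad.inL U.X U.X f ≫ DomComonad.Hom.mapL (MonObj.mul (X := U.X)) f =
          𝟙 _ := by
        ext
        · exact Category.id_comp _
        · exact lam_mul U f
      have k₁ := congrArg U.X.E.map k₀
      ext
      · refine (Category.assoc _ _ _).trans (Eq.trans ?_ (Category.comp_id _))
        exact congrArg (U.X.sigma f ≫ ·)
          ((U.X.E.map_comp _ _).symm.trans (k₁.trans (U.X.E.map_id _)))
      · exact Category.id_comp _
    have k' := congrArg U.X.E.map k
    rw [Functor.map_comp] at k'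
    exact (Category.assoc _ _ _).trans (congrArg (U.X.sigma _ ≫ ·)
      ((Category.assoc _ _ _).symm.trans (congrArg (· ≫ _) k')))

end NWFS

/-! ### Right lifting data and cofibrant generation -/

section RightLifting

variable {C : Type u} [Category.{v} C] {ι : Type v} (J : ι → Arrow C)

/-- An arrow `g` together with right lifting data with respect to `J`: a choice of fill-in for
every lifting problem from a member of `J` to `g`. -/
structure RightLiftingData where
  arrow : Arrow C
  fill (x : Squares J arrow) : (J x.1).right ⟶ arrow.left
  hom_fill (x : Squares J arrow) : (J x.1).hom ≫ fill x = x.2.left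
  fill_hom (x : Squares J arrow) : fill x ≫ arrow.hom = x.2.right

namespace RightLiftingData

variable {J}

theorem fill_congr (g : RightLiftingData J) {i : ι} {t t' : J i ⟶ g.arrow} (h : t = t') :
    g.fill ⟨i, t⟩ = g.fill ⟨i, t'⟩ := by subst h; rfl

/-- Morphisms: commutative squares that commute with the chosen fill-ins. -/
@[ext] structure Hom (g g' : RightLiftingData J) where
  hom : g.arrow ⟶ g'.arrow
  fill_left (x : Squares J g.arrow) :
    g.fill x ≫ hom.left = g'.fill ⟨x.1, x.2 ≫ hom⟩

instance : Category (RightLiftingData J) where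
  Hom := Hom
  id g := ⟨𝟙 g.arrow, fun x => by
    obtain ⟨i, t⟩ := x
    exact (Category.comp_id _).trans (g.fill_congr (Category.comp_id t).symm)⟩
  comp {g g' g''} a b := ⟨a.hom ≫ b.hom, fun x => by
    refine (Category.assoc _ _ _).symm.trans ((congrArg (· ≫ _) (a.fill_left x)).trans
      ((b.fill_left ⟨x.1, x.2 ≫ a.hom⟩).trans (g''.fill_congr (Category.assoc _ _ _))))⟩
  id_comp _ := Hom.ext (Category.id_comp _)
  comp_id _ := Hom.ext (Category.comp_id _)
  assoc _ _ _ := Hom.ext (Category.assoc _ _ _)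

variable (J) in
/-- The forgetful functor `U_J` to the arrow category. -/
def forget : RightLiftingData J ⥤ Arrow C where
  obj g := g.arrow
  map a := Hom.hom a

end RightLiftingData

end RightLifting

namespace NWFS

variable {C : Type u} [Category.{v} C] (N : NWFS C) {ι : Type v} (J : ι → Arrow C)
  (α : ∀ i, LMapStructure N.toDomComonad (J i))

variable {N} in
/-- The map `p : E g ⟶ C` of an `R`-map `(g : C ⟶ D, p)`. -/
def act (g : N.monad.Algebra) : N.E.obj g.A ⟶ g.A.left := g.a.left

variable {N} in
theorem lam_act (g : N.monad.Algebra) : N.lam g.A ≫ act g = 𝟙 _ :=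
  congrArg Arrow.Hom.left g.unit

variable {N} in
theorem act_hom (g : N.monad.Algebra) : act g ≫ g.A.hom = N.rho g.A := by
  have hr : g.a.right = 𝟙 _ :=
    (Category.id_comp _).symm.trans (congrArg Arrow.Hom.right g.unit)
  refine (Arrow.w g.a).trans ?_
  rw [hr]
  exact Category.comp_id _

variable {N} in
theorem act_nat {g g' : N.monad.Algebra} (m : g ⟶ g') :
    N.E.map m.f ≫ act g' = act g ≫ m.f.left := congrArg Arrow.Hom.left m.h

/-- The canonical functor `θ` from `R`-maps to right lifting data, for a family `J` of arrows
with chosen `L`-map structures `α`: an `R`-map `(g, p)` solves the lifting problem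
`x = (h, k) : f ⟶ g` by the composite `p · E(h, k) · α_f`. -/
def theta : N.monad.Algebra ⥤ RightLiftingData J where
  obj g :=
    { arrow := g.A
      fill := fun x => (α x.1).s ≫ N.E.map x.2 ≫ act g
      hom_fill := fun x => by
        rw [← Category.assoc, (α x.1).hom_s, ← Category.assoc, N.lam_nat, Category.assoc,
          lam_act, Category.comp_id]
      fill_hom := fun x => by
        rw [Category.assoc, Category.assoc, act_hom, N.rho_nat, ← Category.assoc, (α x.1).s_rho,
          Category.id_comp] }
  map {g g'} m := ⟨m.f, fun x => by
    change ((α x.1).s ≫ N.E.map x.2 ≫ act g) ≫ m.f.left =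
      (α x.1).s ≫ N.E.map (x.2 ≫ m.f) ≫ act g'
    rw [Functor.map_comp, Category.assoc, Category.assoc, Category.assoc, act_nat]⟩
  map_id _ := rfl
  map_comp _ _ := rfl

/-- `(L, R, Δ)` is cofibrantly generated by `(J, α)` if the canonical functor `θ`, which commutes
with the forgetful functors to the arrow category, is an isomorphism of categories. -/
def CofibrantlyGenerated : Prop :=
  N.theta J α ⋙ RightLiftingData.forget J = N.monad.forget ∧ (N.theta J α).IsIso

end NWFS

/-! ### Free monoids on pointed objects -/

section FreeMonoid

universe w v₁ u₁

variable {V : Type u₁} [Category.{v₁} V] [MonoidalCategory V]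

/-- `(U, η, μ)` is the free monoid on the pointed object `(T, τ)` via `χ : T ⟶ U`. -/
structure IsFreeMonoid {T : V} (τ : 𝟙_ V ⟶ T) (U : Mon V) (χ : T ⟶ U.X) : Prop where
  point : τ ≫ χ = MonObj.one
  existsUnique (W : Mon V) (ψ : T ⟶ W.X) : τ ≫ ψ = MonObj.one →
    ∃! φ : U ⟶ W, χ ≫ φ.hom = ψ

/-- The map `τ ⊗ X : X ≅ I ⊗ X ⟶ T ⊗ X`. -/
def pointTensor {T : V} (τ : 𝟙_ V ⟶ T) (X : V) : X ⟶ T ⊗ X := (λ_ X).inv ≫ τ ▷ X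

/-- The free `T`-module sequence for `A`, where `(T, τ)` is a pointed object. -/
structure FreeModuleSequence {T : V} (τ : 𝟙_ V ⟶ T) (A : V) where
  X : Ordinal.{w} ⥤ V
  act (a : Ordinal.{w}) : T ⊗ X.obj a ⟶ X.obj (Order.succ a)
  act_nat {a b : Ordinal.{w}} (h : a ≤ b) :
    T ◁ X.map (homOfLE h) ≫ act b = act a ≫ X.map (homOfLE (Order.succ_le_succ h))
  point_act (a : Ordinal.{w}) :
    pointTensor τ (X.obj a) ≫ act a = X.map (homOfLE (Order.le_succ a))
  /-- `X₀ = A` and `X₁ = T ⊗ A`. -/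
  zero : X.obj 0 ≅ A
  isIso_act_zero : IsIso (act 0)
  /-- At a successor `a⁺` the map `act a⁺` is the coequaliser of the two displayed maps
  `T ⊗ X_a ⟶ T ⊗ X_{a⁺}`. -/
  condition_succ (a : Ordinal.{w}) :
    (act a ≫ pointTensor τ (X.obj (Order.succ a))) ≫ act (Order.succ a) =
      (T ◁ pointTensor τ (X.obj a) ≫ T ◁ act a) ≫ act (Order.succ a)
  isColimit_succ (a : Ordinal.{w}) :
    Nonempty (IsColimit (Cofork.ofπ (act (Order.succ a)) (condition_succ a)))
  /-- At a limit ordinal `c`, `X_c` is the colimit of the `X_a` for `a < c`. -/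
  continuous : X.IsWellOrderContinuous
  /-- At a limit ordinal `c` the map `act c` is the coequaliser of the two maps
  `colim_{a < c} (T ⊗ X_a) ⟶ T ⊗ X_c`, given on the summand `a` by
  `T ⊗ X_a ⟶ X_{a⁺} ⟶ X_c ⟶ T ⊗ X_c` and by `T ⊗ X_a ⟶ T ⊗ X_c`. -/
  condition_limit (c : Ordinal.{w}) (hc : Order.IsSuccLimit c) (a : Ordinal.{w}) (h : a < c) :
    act a ≫ X.map (homOfLE (Order.succ_le_of_lt h)) ≫ pointTensor τ (X.obj c) ≫ act c =
      T ◁ X.map (homOfLE h.le) ≫ act c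
  existsUnique_limit (c : Ordinal.{w}) (hc : Order.IsSuccLimit c) {Z : V}
    (k : T ⊗ X.obj c ⟶ Z)
    (hk : ∀ (a : Ordinal.{w}) (h : a < c),
      act a ≫ X.map (homOfLE (Order.succ_le_of_lt h)) ≫ pointTensor τ (X.obj c) ≫ k =
        T ◁ X.map (homOfLE h.le) ≫ k) :
    ∃! l : X.obj (Order.succ c) ⟶ Z, act c ≫ l = k

end FreeMonoid

/-! ### The n.w.f.s. generated by a family of arrows -/

section Generated

variable {C : Type u} [Category.{v} C] [HasColimits C] {ι : Type v} (J : ι → Arrow C)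

/-- The unique point `τ : I ⟶ L¹` of the one-step comonad. -/
noncomputable def oneStepPoint : 𝟙_ (DomComonad C) ⟶ OneStep.comonad J :=
  DomComonad.fromUnit (OneStep.comonad J)

variable {J} in
/-- Convergence of a free `L¹`-module sequence `L⁰ ⟶ L¹ ⟶ L² ⟶ ⋯`: at each arrow `f` of `C`,
some connecting map `E^a f ⟶ E^{a⁺} f` is invertible. -/
def ConvergesPointwise {A : DomComonad C} (X : FreeModuleSequence.{v} (oneStepPoint J) A) : Prop :=
  ∀ f : Arrow C, ∃ a : Ordinal.{v},
    IsIso (DomComonad.Hom.app (X.X.map (homOfLE (Order.le_succ a))) f)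

variable {J} in
/-- The `L`-map structures `β` on the members `f` of `J` induced by a morphism `χ : L¹ ⟶ L`:
`β_f = χ_f · α_f`, for `α` the canonical `L¹`-map structures. -/
noncomputable def inducedStructure {U : Mon (DomComonad C)} (χ : OneStep.comonad J ⟶ U.X) (i : ι) :
    LMapStructure (NWFS.ofMon U).toDomComonad (J i) :=
  (OneStep.canonical J i).map χ

end Generated

end Garner

/-!
A natural weak factorisation system is cofibrantly generated as soon as its free `R`-algebras are
free lifting structures, that is, reflections of arrows along the forgetful functor `U_J` from right
lifting data (`NWFS.cofibrantlyGenerated_of_isFreeLift`). Indeed, the unique morphism of lifting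
structures from the free one on `g` to a given one on `g` that restricts to the identity is then an
`R`-algebra structure, and all required equations hold because two morphisms of lifting structures
out of a free one agree once they agree on the unit. The proof has two halves.

*Free lifting structures exist* (`FreeModuleSequence.nonempty_freeLifts`). Lifting structures are
algebras for the pointed endofunctor `R¹` of the one-step comonad. Colimits of connected diagrams
of comonads over `dom` are computed pointwise (`DomComonad.ev_preservesColimitsOfShape`), so at
each arrow `f` the given sequence is the transfinite sequence `E⁰f ⟶ E¹f ⟶ ⋯` that constructs free
`R¹`-algebras. By transfinite induction, a square from `f` to an arrow with a lifting structure has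
a unique extension to each stage compatible with all earlier actions
(`PointwiseSequence.IsExtension.existsUnique`). At a stage where the sequence has converged, the
action becomes a lifting structure, and these extensions are exactly the morphisms of lifting
structures (`PointwiseSequence.isFreeLift_str`).

*They are the free algebras of the free monoid* (`FreeLifts.isFreeLift_of_isFreeMonoid`). Free
lifting structures form a `⊗`-monoid of comonads over `dom`. Its comultiplication comes from the
composition of lifting structures: `σ_f` is the unique morphism from the free structure on `ρ_f` to
the composite of those on `ρ_{λ_f}` and `ρ_f` that extends `λ_{λ_f}`. This monoid receives a map
from the one-step comonad, hence from the free monoid `U`. In the other direction, freeness of the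
lifting structures gives a morphism of monoids into `U`. It is compatible with the
comultiplications because the distributive law says that the comultiplication of `U` is a morphism
of lifting structures (`NWFS.liftMap_freeStr_sigma`). The two morphisms are mutually inverse and
preserve lifting structures.
-/

namespace Garner

/-! ### Lifting structures and free lifting structures -/

section LiftingStructures

variable {C : Type u} [Category.{v} C] {ι : Type v} (J : ι → Arrow C)

/-- Right lifting data with respect to `J` on a fixed map `p : X ⟶ Y`: the unbundled form of
`RightLiftingData`, in which the two sides of a lifting problem are separate arguments. -/
structure LiftStr {X Y : C} (p : X ⟶ Y) where
  fill (i : ι) (t : (J i).left ⟶ X) (b : (J i).right ⟶ Y) (h : t ≫ p = (J i).hom ≫ b) :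
    (J i).right ⟶ X
  hom_fill (i : ι) (t : (J i).left ⟶ X) (b : (J i).right ⟶ Y) (h : t ≫ p = (J i).hom ≫ b) :
    (J i).hom ≫ fill i t b h = t
  fill_hom (i : ι) (t : (J i).left ⟶ X) (b : (J i).right ⟶ Y) (h : t ≫ p = (J i).hom ≫ b) :
    fill i t b h ≫ p = b

variable {J}

namespace LiftStr

variable {X Y Z : C} {p : X ⟶ Y} {q : Y ⟶ Z}

theorem fill_congr (G : LiftStr J p) {i : ι} {t t' : (J i).left ⟶ X} {b b' : (J i).right ⟶ Y}
    (ht : t = t') (hb : b = b') (h : t ≫ p = (J i).hom ≫ b) (h' : t' ≫ p = (J i).hom ≫ b') :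
    G.fill i t b h = G.fill i t' b' h' := by
  subst ht hb; rfl

/-- Lifting structures compose: a lifting problem against `p ≫ q` is solved first against `q` and
then against `p`. -/
def comp (G : LiftStr J p) (H : LiftStr J q) : LiftStr J (p ≫ q) where
  fill i t b h := G.fill i t (H.fill i (t ≫ p) b ((Category.assoc _ _ _).trans h))
    (H.hom_fill _ _ _ _).symm
  hom_fill _ _ _ _ := G.hom_fill _ _ _ _
  fill_hom _ _ _ _ := by rw [← Category.assoc, G.fill_hom, H.fill_hom]

end LiftStr

/-- A morphism of lifting structures: the square `(m, n)` commutes and preserves the chosen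
fill-ins. -/
structure LiftMap {X Y X' Y' : C} {p : X ⟶ Y} {p' : X' ⟶ Y'} (G : LiftStr J p)
    (G' : LiftStr J p') (m : X ⟶ X') (n : Y ⟶ Y') : Prop where
  comm : m ≫ p' = p ≫ n
  fill (i : ι) (t : (J i).left ⟶ X) (b : (J i).right ⟶ Y) (h : t ≫ p = (J i).hom ≫ b)
    (h' : (t ≫ m) ≫ p' = (J i).hom ≫ b ≫ n) :
    G.fill i t b h ≫ m = G'.fill i (t ≫ m) (b ≫ n) h'

namespace LiftMap

variable {X Y Z W X' Y' Z' X'' Y'' : C} {p : X ⟶ Y} {q : Y ⟶ Z} {r : Z ⟶ W} {p' : X' ⟶ Y'}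
  {q' : Y' ⟶ Z'} {p'' : X'' ⟶ Y''}

theorem id (G : LiftStr J p) : LiftMap G G (𝟙 X) (𝟙 Y) where
  comm := by simp
  fill i t b h h' := by
    rw [Category.comp_id]
    exact G.fill_congr (Category.comp_id _).symm (Category.comp_id _).symm _ _

theorem comp {G : LiftStr J p} {G' : LiftStr J p'} {G'' : LiftStr J p''} {m : X ⟶ X'}
    {n : Y ⟶ Y'} {m' : X' ⟶ X''} {n' : Y' ⟶ Y''} (a : LiftMap G G' m n)
    (b : LiftMap G' G'' m' n') : LiftMap G G'' (m ≫ m') (n ≫ n') where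
  comm := by rw [Category.assoc, b.comm, reassoc_of% a.comm]
  fill i t c h h' := by
    have h₁ : (t ≫ m) ≫ p' = (J i).hom ≫ c ≫ n := by
      rw [Category.assoc, a.comm, reassoc_of% h]
    rw [← Category.assoc, a.fill i t c h h₁, b.fill i _ _ h₁ (by simpa using h')]
    exact G''.fill_congr (Category.assoc _ _ _) (Category.assoc _ _ _) _ _

theorem congr {G : LiftStr J p} {G' : LiftStr J p'} {m m' : X ⟶ X'} {n n' : Y ⟶ Y'}
    (a : LiftMap G G' m n) (hm : m = m') (hn : n = n') : LiftMap G G' m' n' := by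
  subst hm hn; exact a

/-- Pasting of morphisms of lifting structures along composition of maps. -/
theorem paste {G : LiftStr J p} {H : LiftStr J q} {G' : LiftStr J p'} {H' : LiftStr J q'}
    {m : X ⟶ X'} {n : Y ⟶ Y'} {k : Z ⟶ Z'} (a : LiftMap G G' m n) (b : LiftMap H H' n k) :
    LiftMap (G.comp H) (G'.comp H') m k where
  comm := by rw [reassoc_of% a.comm, b.comm, Category.assoc]
  fill i t c h h' := by
    have h₁ : ((t ≫ p) ≫ n) ≫ q' = (J i).hom ≫ c ≫ k := by
      simp only [Category.assoc, b.comm, reassoc_of% h]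
    refine (a.fill i t _ _ ?_).trans (G'.fill_congr rfl ?_ _ _)
    · rw [reassoc_of% (H.hom_fill i (t ≫ p) c ((Category.assoc _ _ _).trans h)), Category.assoc,
        a.comm]
    · rw [b.fill i _ _ _ h₁]
      exact H'.fill_congr (by simp [a.comm]) rfl _ _

/-- The square `(p, 1)` from a composite `p ≫ q` to `q` preserves fill-ins. -/
theorem snd (G : LiftStr J p) (H : LiftStr J q) : LiftMap (G.comp H) H p (𝟙 Z) where
  comm := (Category.comp_id _).symm
  fill _ _ _ _ _ := (G.fill_hom _ _ _ _).trans
    (H.fill_congr rfl (Category.comp_id _).symm _ _)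

/-- If the lower side of a morphism of lifting structures factors through `q`, then the morphism
extends to the composite with `q`. -/
theorem ofComp {G : LiftStr J p} {G' : LiftStr J p'} {m : X ⟶ X'} {n : Z ⟶ Y'}
    (H : LiftStr J q) (a : LiftMap G G' m (q ≫ n)) : LiftMap (G.comp H) G' m n where
  comm := by rw [a.comm, Category.assoc]
  fill i t b h h' := by
    have e : (H.fill i (t ≫ p) b ((Category.assoc _ _ _).trans h)) ≫ q ≫ n = b ≫ n := by
      rw [← Category.assoc, H.fill_hom]
    exact (a.fill i t _ _ (by rw [e]; exact h')).trans (G'.fill_congr rfl e _ _)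

theorem assoc (G : LiftStr J p) (H : LiftStr J q) (K : LiftStr J r) :
    LiftMap ((G.comp H).comp K) (G.comp (H.comp K)) (𝟙 X) (𝟙 W) where
  comm := by simp
  fill i t b h h' := by
    rw [Category.comp_id]
    refine G.fill_congr (Category.comp_id _).symm (H.fill_congr ?_ ?_ _ _) _ _
    · rw [Category.comp_id]
    · exact K.fill_congr (by simp) (Category.comp_id _).symm _ _

end LiftMap

/-- The lifting structure `G` on `ρ`, with unit `l`, is free on the map `l ≫ ρ`: it has the
universal property of a reflection along the forgetful functor from lifting structures to the
arrow category. -/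
def IsFreeLift {X E Y : C} {ρ : E ⟶ Y} (G : LiftStr J ρ) (l : X ⟶ E) : Prop :=
  ∀ ⦃Z W : C⦄ (g : Z ⟶ W) (H : LiftStr J g) (t : X ⟶ Z) (b : Y ⟶ W),
    t ≫ g = (l ≫ ρ) ≫ b → ∃! m : E ⟶ Z, l ≫ m = t ∧ LiftMap G H m b

namespace IsFreeLift

variable {X E Y Z W : C} {ρ : E ⟶ Y} {G : LiftStr J ρ} {l : X ⟶ E} {g : Z ⟶ W}

/-- The extension along the unit of a free lifting structure. -/
noncomputable def desc (h : IsFreeLift G l) (H : LiftStr J g) (t : X ⟶ Z) (b : Y ⟶ W)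
    (w : t ≫ g = (l ≫ ρ) ≫ b) : E ⟶ Z :=
  (h g H t b w).choose

theorem fac (h : IsFreeLift G l) (H : LiftStr J g) (t : X ⟶ Z) (b : Y ⟶ W)
    (w : t ≫ g = (l ≫ ρ) ≫ b) : l ≫ h.desc H t b w = t :=
  (h g H t b w).choose_spec.1.1

theorem liftMap_desc (h : IsFreeLift G l) (H : LiftStr J g) (t : X ⟶ Z) (b : Y ⟶ W)
    (w : t ≫ g = (l ≫ ρ) ≫ b) : LiftMap G H (h.desc H t b w) b :=
  (h g H t b w).choose_spec.1.2

theorem hom_ext (h : IsFreeLift G l) {H : LiftStr J g} {m m' : E ⟶ Z} {b : Y ⟶ W}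
    (a : LiftMap G H m b) (a' : LiftMap G H m' b) (e : l ≫ m = l ≫ m') : m = m' := by
  have w : (l ≫ m') ≫ g = (l ≫ ρ) ≫ b := by
    rw [Category.assoc, a'.comm, Category.assoc]
  exact (h g H (l ≫ m') b w).unique ⟨e, a⟩ ⟨rfl, a'⟩

end IsFreeLift

variable (J)

/-- A choice, for every arrow `f`, of a free lifting structure on `f` whose unit is the identity
on codomains. It amounts to a factorisation `f = λ_f ≫ ρ_f` and a free lifting structure on
`ρ_f`. -/
structure FreeLifts where
  E (f : Arrow C) : C
  lam (f : Arrow C) : f.left ⟶ E f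
  rho (f : Arrow C) : E f ⟶ f.right
  fac (f : Arrow C) : lam f ≫ rho f = f.hom
  str (f : Arrow C) : LiftStr J (rho f)
  free (f : Arrow C) : IsFreeLift (str f) (lam f)

end LiftingStructures


/-! ### The natural weak factorisation system of free lifting structures -/

namespace FreeLifts

variable {C : Type u} [Category.{v} C] {ι : Type v} {J : ι → Arrow C} (F : FreeLifts J)

section Extension

variable {F}
variable {f : Arrow C} {Z W : C} {g : Z ⟶ W}

theorem hom_ext {H : LiftStr J g} {m m' : F.E f ⟶ Z} {b : f.right ⟶ W}
    (a : LiftMap (F.str f) H m b) (a' : LiftMap (F.str f) H m' b)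
    (e : F.lam f ≫ m = F.lam f ≫ m') : m = m' :=
  (F.free f).hom_ext a a' e

/-- The extension of the square `(t, b) : f ⟶ g` to a morphism of lifting structures. -/
noncomputable def desc (H : LiftStr J g) (t : f.left ⟶ Z) (b : f.right ⟶ W)
    (w : t ≫ g = f.hom ≫ b) : F.E f ⟶ Z :=
  (F.free f).desc H t b (by rw [F.fac, w])

theorem lam_desc (H : LiftStr J g) (t : f.left ⟶ Z) (b : f.right ⟶ W)
    (w : t ≫ g = f.hom ≫ b) : F.lam f ≫ desc H t b w = t :=
  (F.free f).fac _ _ _ _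

theorem liftMap_desc (H : LiftStr J g) (t : f.left ⟶ Z) (b : f.right ⟶ W)
    (w : t ≫ g = f.hom ≫ b) : LiftMap (F.str f) H (F.desc H t b w) b :=
  (F.free f).liftMap_desc _ _ _ _

end Extension

/-- The action of the free lifting structure on morphisms of arrows. -/
noncomputable def map {f g : Arrow C} (s : f ⟶ g) : F.E f ⟶ F.E g :=
  desc (F.str g) (s.left ≫ F.lam g) s.right (by rw [Category.assoc, F.fac, Arrow.w])

theorem lam_map {f g : Arrow C} (s : f ⟶ g) : F.lam f ≫ F.map s = s.left ≫ F.lam g :=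
  lam_desc _ _ _ _

theorem lam_map_assoc {f g : Arrow C} (s : f ⟶ g) {Z : C} (k : F.E g ⟶ Z) :
    F.lam f ≫ F.map s ≫ k = s.left ≫ F.lam g ≫ k := by
  rw [← Category.assoc, lam_map, Category.assoc]

theorem liftMap_map {f g : Arrow C} (s : f ⟶ g) :
    LiftMap (F.str f) (F.str g) (F.map s) s.right :=
  liftMap_desc _ _ _ _

/-- The functorial factorisation underlying a choice of free lifting structures. -/
noncomputable abbrev fact : FunFact C where
  E :=
    { obj := F.E
      map := F.map
      map_id := fun f => hom_ext (F.liftMap_map (𝟙 f)) (LiftMap.id _)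
        (by rw [lam_map, Category.comp_id]; exact Category.id_comp _)
      map_comp := fun s t => hom_ext (F.liftMap_map (s ≫ t))
        ((F.liftMap_map s).comp (F.liftMap_map t))
        (by rw [lam_map, lam_map_assoc, lam_map]; exact Category.assoc _ _ _) }
  lam := F.lam
  rho := F.rho
  lam_nat s := F.lam_map s
  rho_nat s := (F.liftMap_map s).comm
  fac := F.fac

/-- The comultiplication: since lifting structures compose, `λ_{λ_f}` extends uniquely to a
morphism of lifting structures from the free one on `ρ_f` to the composite of the free ones on
`ρ_{λ_f}` and `ρ_f`. -/
noncomputable def sigma (f : Arrow C) : F.E f ⟶ F.E (Arrow.mk (F.lam f)) :=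
  desc ((F.str (Arrow.mk (F.lam f))).comp (F.str f)) (F.lam (Arrow.mk (F.lam f))) (𝟙 _) (by
    rw [← Category.assoc, F.fac, Category.comp_id]; exact F.fac f)

theorem lam_sigma (f : Arrow C) : F.lam f ≫ F.sigma f = F.lam (Arrow.mk (F.lam f)) :=
  lam_desc _ _ _ _

theorem lam_sigma_assoc (f : Arrow C) {Z : C} (k : F.E (Arrow.mk (F.lam f)) ⟶ Z) :
    F.lam f ≫ F.sigma f ≫ k = F.lam (Arrow.mk (F.lam f)) ≫ k := by
  rw [← Category.assoc, lam_sigma]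

theorem liftMap_sigma (f : Arrow C) :
    LiftMap (F.str f) ((F.str (Arrow.mk (F.lam f))).comp (F.str f)) (F.sigma f) (𝟙 _) :=
  liftMap_desc _ _ _ _

/-- The comonad over `dom` determined by free lifting structures. Each of its laws compares two
morphisms of lifting structures that agree on the unit. -/
noncomputable def comonad : DomComonad C where
  toFunFact := F.fact
  sigma := F.sigma
  lam_sigma := F.lam_sigma
  sigma_nat {f g} s :=
    hom_ext (((F.liftMap_map s).comp (F.liftMap_sigma g)).congr rfl (Category.comp_id _))
      (((F.liftMap_sigma f).comp ((F.liftMap_map (F.fact.L.map s)).paste (F.liftMap_map s))).congr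
        rfl (Category.id_comp _))
      (by
        rw [lam_map_assoc, lam_sigma, lam_sigma_assoc]
        exact (F.lam_map (F.fact.L.map s)).symm)
  sigma_rho f :=
    hom_ext (((F.liftMap_sigma f).comp (LiftMap.snd _ _)).congr rfl (Category.comp_id _))
      (LiftMap.id _) (by
        rw [lam_sigma_assoc, Category.comp_id]
        exact F.fac _)
  sigma_Phi f :=
    hom_ext (((F.liftMap_sigma f).comp (LiftMap.ofComp (F.str f)
        ((F.liftMap_map (F.fact.Phi f)).congr (n' := F.rho f ≫ 𝟙 _) rfl
          (Category.comp_id _).symm))).congr rfl (Category.comp_id _))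
      (LiftMap.id _) (by
        rw [lam_sigma_assoc, Category.comp_id]
        exact (F.lam_map (F.fact.Phi f)).trans (Category.id_comp _))
  coassoc f := by
    let e : Arrow.mk (F.lam f) ⟶ Arrow.mk (F.lam (Arrow.mk (F.lam f))) :=
      Arrow.homMk (𝟙 f.left) (F.sigma f) ((Category.id_comp _).trans (F.lam_sigma f).symm)
    change F.sigma f ≫ F.map e = F.sigma f ≫ F.sigma (Arrow.mk (F.lam f))
    have h₁ := ((F.liftMap_sigma f).comp ((F.liftMap_map e).paste (F.liftMap_sigma f))).congr
      rfl (Category.comp_id _)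
    have h₂ := (((F.liftMap_sigma f).comp ((F.liftMap_sigma (Arrow.mk (F.lam f))).paste
      (LiftMap.id (F.str f)))).comp (LiftMap.assoc _ _ _)).congr (Category.comp_id _)
        ((Category.comp_id _).trans (Category.comp_id _))
    refine hom_ext h₁ h₂ ?_
    rw [lam_sigma_assoc, lam_sigma_assoc, lam_sigma]
    exact (F.lam_map e).trans (Category.id_comp _)

/-- The multiplication `E R f ⟶ E f`: the counit of the adjunction between arrows and lifting
structures. -/
noncomputable def pi (f : Arrow C) : F.E (Arrow.mk (F.rho f)) ⟶ F.E f :=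
  desc (F.str f) (𝟙 _) (𝟙 _) ((Category.id_comp _).trans (Category.comp_id _).symm)

theorem lam_pi (f : Arrow C) : F.lam (Arrow.mk (F.rho f)) ≫ F.pi f = 𝟙 _ :=
  lam_desc _ _ _ _

theorem lam_pi_assoc (f : Arrow C) {Z : C} (k : F.E f ⟶ Z) :
    F.lam (Arrow.mk (F.rho f)) ≫ F.pi f ≫ k = k := by
  rw [← Category.assoc, lam_pi, Category.id_comp]

theorem liftMap_pi (f : Arrow C) :
    LiftMap (F.str (Arrow.mk (F.rho f))) (F.str f) (F.pi f) (𝟙 _) :=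
  liftMap_desc _ _ _ _

/-- The multiplication of the monoid of free lifting structures, as a map of comonads over
`dom`. -/
noncomputable def mul : DomComonad.tensor F.comonad F.comonad ⟶ F.comonad :=
  DomComonad.Hom.mk (A := DomComonad.tensor F.comonad F.comonad) (B := F.comonad)
  (app := F.pi)
  (nat := fun {f g} s =>
    hom_ext (((F.liftMap_map (F.fact.R.map s)).comp (F.liftMap_pi g)).congr rfl
        (Category.comp_id _))
      (((F.liftMap_pi f).comp (F.liftMap_map s)).congr rfl (Category.id_comp _))
      (by
        change F.lam (Arrow.mk (F.rho f)) ≫ F.map (F.fact.R.map s) ≫ F.pi g =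
          F.lam (Arrow.mk (F.rho f)) ≫ F.pi f ≫ F.map s
        rw [lam_pi_assoc]
        refine (F.lam_map_assoc (F.fact.R.map s) _).trans ?_
        exact (congrArg (F.map s ≫ ·) (F.lam_pi g)).trans (Category.comp_id _)))
  (lam := fun f => (Category.assoc _ _ _).trans
    ((congrArg (F.lam f ≫ ·) (F.lam_pi f)).trans (Category.comp_id _)))
  (rho := fun f => (F.liftMap_pi f).comm.trans (Category.comp_id _))
  (sigma := fun f => by
    let e : Arrow.mk ((DomComonad.tensor F.comonad F.comonad).lam f) ⟶ Arrow.mk (F.lam f) :=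
      Arrow.homMk (𝟙 f.left) (F.pi f) ((Category.id_comp _).trans ((Category.assoc _ _ _).trans
        ((congrArg (F.lam f ≫ ·) (F.lam_pi f)).trans (Category.comp_id _))).symm)
    let k : Arrow.mk (F.lam (Arrow.mk (F.rho f))) ⟶ Arrow.mk (F.rho (Arrow.mk (F.lam f))) :=
      Arrow.homMk (F.sigma f) (F.pi f) ((F.comonad.sigma_rho f).trans (F.lam_pi f).symm)
    change F.pi f ≫ F.sigma f = (F.sigma (Arrow.mk (F.rho f)) ≫
      F.map (DomComonad.midMap F.comonad F.comonad f)) ≫ F.map (F.fact.R.map e) ≫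
        F.pi (Arrow.mk (F.lam f))
    have hk : DomComonad.midMap F.comonad F.comonad f ≫ F.fact.R.map e = k := by
      have h : DomComonad.inL F.comonad F.comonad f ≫ e = 𝟙 _ := by
        ext
        · exact Category.id_comp _
        · exact F.lam_pi f
      ext
      · refine (Category.assoc _ _ _).trans (Eq.trans ?_ (Category.comp_id _))
        exact congrArg (F.sigma f ≫ ·) ((F.fact.E.map_comp _ _).symm.trans
          ((congrArg F.fact.E.map h).trans (F.fact.E.map_id _)))
      · exact Category.id_comp _
    have hk' : F.map (DomComonad.midMap F.comonad F.comonad f) ≫ F.map (F.fact.R.map e) =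
        F.map k := (F.fact.E.map_comp _ _).symm.trans (congrArg F.fact.E.map hk)
    refine Eq.trans ?_ ((Category.assoc _ _ _).trans (congrArg (F.sigma _ ≫ ·)
      ((Category.assoc _ _ _).symm.trans (congrArg (· ≫ F.pi _) hk')))).symm
    have h₁ := ((F.liftMap_pi f).comp (F.liftMap_sigma f)).congr rfl (Category.comp_id _)
    have h₂ := ((F.liftMap_sigma (Arrow.mk (F.rho f))).comp
      ((((F.liftMap_map k).comp (F.liftMap_pi (Arrow.mk (F.lam f)))).congr (n' := F.pi f) rfl
        (Category.comp_id _)).paste (F.liftMap_pi f))).congr rfl (Category.comp_id _)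
    refine hom_ext h₁ h₂ ?_
    rw [lam_pi_assoc]
    refine Eq.symm ((F.lam_sigma_assoc _ _).trans ((F.lam_map_assoc k _).trans ?_))
    exact (congrArg (F.sigma f ≫ ·) (F.lam_pi _)).trans (Category.comp_id _))

/-- The monoid of comonads over `dom` determined by free lifting structures. -/
@[reducible] noncomputable def monObj : MonObj F.comonad where
  one := DomComonad.fromUnit F.comonad
  mul := F.mul
  one_mul := DomComonad.hom_ext fun f => by
    refine Eq.trans ?_ (F.lam_pi f)
    exact congrArg (· ≫ F.pi f)
      ((congrArg (· ≫ _) (DomComonad.map_homMk_id _ _ _)).trans (Category.id_comp _))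
  mul_one := DomComonad.hom_ext fun f => by
    have h : F.map (F.fact.Lambda f) ≫ F.pi f = 𝟙 _ :=
      hom_ext (((F.liftMap_map (F.fact.Lambda f)).comp (F.liftMap_pi f)).congr rfl
        (Category.comp_id _)) (LiftMap.id _) (by
          rw [Category.comp_id]
          refine (F.lam_map_assoc (F.fact.Lambda f) _).trans ?_
          exact (congrArg (F.lam f ≫ ·) (F.lam_pi f)).trans (Category.comp_id _))
    refine Eq.trans ?_ h
    exact congrArg (· ≫ F.pi f) (Category.comp_id _)
  mul_assoc := DomComonad.hom_ext fun f => by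
    let e : Arrow.mk (F.rho (Arrow.mk (F.rho f))) ⟶ Arrow.mk (F.rho f) :=
      Arrow.homMk (F.pi f) (𝟙 f.right) (F.liftMap_pi f).comm
    have h : F.pi (Arrow.mk (F.rho f)) ≫ F.pi f = F.map e ≫ F.pi f :=
      hom_ext ((F.liftMap_pi _).comp (F.liftMap_pi f)) ((F.liftMap_map e).comp (F.liftMap_pi f))
        (by
          rw [lam_pi_assoc]
          refine Eq.symm ((F.lam_map_assoc e _).trans ?_)
          exact (congrArg (F.pi f ≫ ·) (F.lam_pi f)).trans (Category.comp_id _))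
    have h₁ : DomComonad.Hom.app (F.mul ▷ F.comonad) f = F.pi (Arrow.mk (F.rho f)) :=
      (congrArg (· ≫ _) (DomComonad.map_homMk_id _ _ _)).trans (Category.id_comp _)
    have h₂ : DomComonad.Hom.app (F.comonad ◁ F.mul) f = F.map e := Category.comp_id _
    refine (congrArg (· ≫ F.pi f) h₁).trans (h.trans ?_)
    exact ((Category.id_comp _).trans (congrArg (· ≫ F.pi f) h₂)).symm

/-- The `⊗`-monoid of free lifting structures. -/
noncomputable def mon : Mon (DomComonad C) where
  X := F.comonad
  mon := F.monObj

section OneStep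

variable [HasColimits C]

/-- The map from the one-step comonad to the free lifting structures. The cell of a square
`x = (h, k)` goes to the chosen solution of the lifting problem `(h ≫ λ_f, k)` against `ρ_f`. -/
noncomputable def fromOneStepApp (f : Arrow C) : OneStep.obj J f ⟶ F.E f :=
  OneStep.desc J (F.lam f)
    (fun x => (F.str f).fill x.1 (x.2.left ≫ F.lam f) x.2.right
      (by rw [Category.assoc, F.fac, Arrow.w]))
    (fun _ => (F.str f).hom_fill _ _ _ _)

theorem lam_fromOneStepApp (f : Arrow C) :
    OneStep.lam J f ≫ F.fromOneStepApp f = F.lam f := OneStep.lam_desc _ _ _ _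

theorem cell_fromOneStepApp {f : Arrow C} (x : Squares J f) :
    OneStep.cell J x ≫ F.fromOneStepApp f =
      (F.str f).fill x.1 (x.2.left ≫ F.lam f) x.2.right
        (by rw [Category.assoc, F.fac, Arrow.w]) := OneStep.cell_desc _ _ _ _ _

/-- The map `χ` from the one-step comonad to the comonad of free lifting structures. -/
noncomputable def fromOneStep : OneStep.comonad J ⟶ F.comonad :=
  DomComonad.Hom.mk (A := OneStep.comonad J) (B := F.comonad)
  (app := F.fromOneStepApp)
  (nat := fun {f g} s => OneStep.hom_ext J
    (by
      change OneStep.lam J f ≫ OneStep.map J s ≫ _ = OneStep.lam J f ≫ _ ≫ F.map s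
      rw [← Category.assoc, OneStep.lam_map, Category.assoc, lam_fromOneStepApp,
        ← Category.assoc, lam_fromOneStepApp, lam_map])
    (fun x => by
      change OneStep.cell J x ≫ OneStep.map J s ≫ _ = OneStep.cell J x ≫ _ ≫ F.map s
      have h : ((x.2.left ≫ F.lam f) ≫ F.map s) ≫ F.rho g =
          (J x.1).hom ≫ x.2.right ≫ s.right := by
        rw [Category.assoc, Category.assoc, lam_map_assoc, F.fac, Arrow.w, Arrow.w_assoc]
      refine (Category.assoc _ _ _).symm.trans ((congrArg (· ≫ _) (OneStep.cell_map J s x)).trans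
        ((F.cell_fromOneStepApp _).trans (Eq.symm ((Category.assoc _ _ _).symm.trans
          ((congrArg (· ≫ F.map s) (F.cell_fromOneStepApp x)).trans
            (((F.liftMap_map s).fill _ _ _ _ h).trans ((F.str g).fill_congr ?_ rfl _ _)))))))
      rw [Category.assoc, lam_map]
      exact (Category.assoc _ _ _).symm))
  (lam := F.lam_fromOneStepApp)
  (rho := fun f => OneStep.hom_ext J
    (by
      change OneStep.lam J f ≫ _ ≫ F.rho f = OneStep.lam J f ≫ OneStep.rho J f
      rw [← Category.assoc, lam_fromOneStepApp, F.fac, OneStep.lam_rho])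
    (fun x => by
      change OneStep.cell J x ≫ _ ≫ F.rho f = OneStep.cell J x ≫ OneStep.rho J f
      rw [← Category.assoc, cell_fromOneStepApp, LiftStr.fill_hom, OneStep.cell_rho]))
  (sigma := fun f => by
    let e : Arrow.mk (OneStep.lam J f) ⟶ Arrow.mk (F.lam f) :=
      Arrow.homMk (𝟙 f.left) (F.fromOneStepApp f)
        ((Category.id_comp _).trans (F.lam_fromOneStepApp f).symm)
    change F.fromOneStepApp f ≫ F.sigma f =
      OneStep.sigma J f ≫ OneStep.map J e ≫ F.fromOneStepApp (Arrow.mk (F.lam f))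
    apply OneStep.hom_ext
    · rw [← Category.assoc, lam_fromOneStepApp, lam_sigma, ← Category.assoc, OneStep.lam_sigma,
        ← Category.assoc, OneStep.lam_map, Category.assoc, lam_fromOneStepApp]
      exact (Category.id_comp _).symm
    · intro x
      have h : ((x.2.left ≫ F.lam f) ≫ F.sigma f) ≫ F.rho (Arrow.mk (F.lam f)) ≫ F.rho f =
          (J x.1).hom ≫ x.2.right ≫ 𝟙 _ := by
        have := F.comonad.sigma_rho f
        change F.sigma f ≫ F.rho (Arrow.mk (F.lam f)) = 𝟙 _ at this
        rw [Category.assoc, reassoc_of% this, Category.assoc, F.fac, Arrow.w, Category.comp_id]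
      rw [← Category.assoc, cell_fromOneStepApp, (F.liftMap_sigma f).fill _ _ _ _ h,
        ← Category.assoc, OneStep.cell_sigma, ← Category.assoc, OneStep.cell_map,
        cell_fromOneStepApp]
      refine (F.str _).fill_congr ?_ ?_ _ _
      · rw [Category.assoc, lam_sigma]
        exact congrArg (· ≫ _) (Category.comp_id _).symm
      · refine Eq.trans ?_ (F.cell_fromOneStepApp x).symm
        refine (F.str f).fill_congr ?_ (Category.comp_id _) _ _
        have := F.comonad.sigma_rho f
        change F.sigma f ≫ F.rho (Arrow.mk (F.lam f)) = 𝟙 _ at this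
        rw [Category.assoc, Category.assoc, this, Category.comp_id])

theorem point_fromOneStep :
    oneStepPoint J ≫ F.fromOneStep = MonObj.one (X := F.mon.X) :=
  DomComonad.hom_ext fun f => F.lam_fromOneStepApp f

end OneStep

end FreeLifts


/-! ### Algebras as lifting structures, and the comparison with the free monoid -/

section PointedAlgebras

variable {C : Type u} [Category.{v} C] {ι : Type v} {J : ι → Arrow C} {A : DomComonad C}
  (α : ∀ i, LMapStructure A (J i))

/-- The lifting structure on `g` induced by an algebra `p : E g ⟶ dom g` for the pointed
endofunctor `R`: the lifting problem `s` is solved by `p · E s · α`. -/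
def pointedStr {g : Arrow C} (p : A.E.obj g ⟶ g.left) (hl : A.lam g ≫ p = 𝟙 _)
    (hr : p ≫ g.hom = A.rho g) : LiftStr J g.hom where
  fill i t b h := (α i).s ≫ A.E.map (Arrow.homMk t b h : J i ⟶ g) ≫ p
  hom_fill i t b h := by
    rw [← Category.assoc, (α i).hom_s, ← Category.assoc, A.lam_nat, Category.assoc, hl,
      Category.comp_id]
    rfl
  fill_hom i t b h := by
    rw [Category.assoc, Category.assoc, hr, A.rho_nat, ← Category.assoc, (α i).s_rho,
      Category.id_comp]
    rfl

theorem liftMap_pointedStr {g g' : Arrow C} {p : A.E.obj g ⟶ g.left} (hl : A.lam g ≫ p = 𝟙 _)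
    (hr : p ≫ g.hom = A.rho g) {p' : A.E.obj g' ⟶ g'.left} (hl' : A.lam g' ≫ p' = 𝟙 _)
    (hr' : p' ≫ g'.hom = A.rho g') (s : g ⟶ g') (h : A.E.map s ≫ p' = p ≫ s.left) :
    LiftMap (pointedStr α p hl hr) (pointedStr α p' hl' hr') s.left s.right where
  comm := Arrow.w s
  fill i t b w w' := by
    change ((α i).s ≫ A.E.map (Arrow.homMk t b w : J i ⟶ g) ≫ p) ≫ s.left =
      (α i).s ≫ A.E.map (Arrow.homMk (t ≫ s.left) (b ≫ s.right) w' : J i ⟶ g') ≫ p'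
    have e : (Arrow.homMk (t ≫ s.left) (b ≫ s.right) w' : J i ⟶ g') =
        (Arrow.homMk t b w : J i ⟶ g) ≫ s := by
      ext <;> rfl
    rw [e, Functor.map_comp, Category.assoc, Category.assoc, Category.assoc, h]

end PointedAlgebras

namespace NWFS

variable {C : Type u} [Category.{v} C] (N : NWFS C) {ι : Type v} {J : ι → Arrow C}
  (α : ∀ i, LMapStructure N.toDomComonad (J i))

/-- The lifting structure of the free `R`-algebra on `f`. -/
def freeStr (f : Arrow C) : LiftStr J (N.rho f) :=
  pointedStr α (g := Arrow.mk (N.rho f)) (N.pi f) (N.lam_pi f) (N.pi_rho f)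

/-- The lifting structure of an `R`-algebra. -/
def algStr (g : N.monad.Algebra) : LiftStr J g.A.hom :=
  pointedStr α (act g) (lam_act g) (act_hom g)

theorem liftMap_freeStr_map {f g : Arrow C} (s : f ⟶ g) :
    LiftMap (N.freeStr α f) (N.freeStr α g) (N.E.map s) s.right :=
  liftMap_pointedStr α (N.lam_pi f) (N.pi_rho f) (N.lam_pi g) (N.pi_rho g)
    (N.toFunFact.R.map s) (N.pi_nat s)

theorem liftMap_freeStr_pi (f : Arrow C) :
    LiftMap (N.freeStr α (Arrow.mk (N.rho f))) (N.freeStr α f) (N.pi f) (𝟙 _) :=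
  liftMap_pointedStr α (N.lam_pi _) (N.pi_rho _) (N.lam_pi f) (N.pi_rho f)
    (Arrow.homMk (N.pi f) (𝟙 f.right) ((N.pi_rho f).trans (Category.comp_id _).symm))
    (N.assoc f)

theorem a_right (g : N.monad.Algebra) : g.a.right = 𝟙 _ :=
  (Category.id_comp _).symm.trans (congrArg Arrow.Hom.right g.unit)

theorem act_assoc (g : N.monad.Algebra) :
    N.E.map (Arrow.homMk (act g) (𝟙 _) ((act_hom g).trans (Category.comp_id _).symm) :
      Arrow.mk (N.rho g.A) ⟶ g.A) ≫ act g = N.pi g.A ≫ act g := by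
  have h := congrArg Arrow.Hom.left g.assoc
  refine Eq.trans ?_ h.symm
  have e : (Arrow.homMk (act g) (𝟙 _) ((act_hom g).trans (Category.comp_id _).symm) :
      Arrow.mk (N.rho g.A) ⟶ g.A) = g.a := by
    ext
    · rfl
    · exact (N.a_right g).symm
  rw [e]; rfl

theorem liftMap_act (g : N.monad.Algebra) :
    LiftMap (N.freeStr α g.A) (N.algStr α g) (act g) (𝟙 _) :=
  liftMap_pointedStr α (N.lam_pi _) (N.pi_rho _) (lam_act g) (act_hom g)
    (Arrow.homMk (act g) (𝟙 _) ((act_hom g).trans (Category.comp_id _).symm)) (N.act_assoc g)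

/-- The distributive law says that comultiplication is a morphism of lifting structures. -/
theorem liftMap_freeStr_sigma (f : Arrow C) :
    LiftMap (N.freeStr α f) ((N.freeStr α (Arrow.mk (N.lam f))).comp (N.freeStr α f))
      (N.sigma f) (𝟙 _) where
  comm := by
    refine (Category.assoc _ _ _).symm.trans ((congrArg (· ≫ _) (N.sigma_rho f)).trans ?_)
    exact (Category.id_comp _).trans (Category.comp_id _).symm
  fill i t b h h' := by
    let s : J i ⟶ Arrow.mk (N.rho f) := Arrow.homMk t b h
    let d : (J i).right ⟶ N.E.obj f := (α i).s ≫ N.E.map s ≫ N.pi f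
    let k : Arrow.mk (N.lam (Arrow.mk (N.rho f))) ⟶ Arrow.mk (N.rho (Arrow.mk (N.lam f))) :=
      Arrow.homMk (N.sigma f) (N.pi f) ((N.sigma_rho f).trans (N.lam_pi f).symm)
    let a : J i ⟶ Arrow.mk (N.lam (J i)) :=
      Arrow.homMk (𝟙 _) (α i).s ((Category.id_comp _).trans (α i).hom_s.symm)
    have h₁ : ((t ≫ N.sigma f) ≫ N.rho (Arrow.mk (N.lam f))) ≫ N.rho f = (J i).hom ≫ b ≫ 𝟙 _ := by
      rw [← h', Category.assoc, Category.assoc]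
    have hd : (N.freeStr α f).fill i ((t ≫ N.sigma f) ≫ N.rho (Arrow.mk (N.lam f))) (b ≫ 𝟙 _) h₁ =
        d := by
      refine (N.freeStr α f).fill_congr ?_ (Category.comp_id _) _ h
      rw [Category.assoc, N.sigma_rho, Category.comp_id]
    have hs : (t ≫ N.sigma f) ≫ N.rho (Arrow.mk (N.lam f)) = (J i).hom ≫ d := by
      rw [← hd]; exact ((N.freeStr α f).hom_fill _ _ _ _).symm
    refine Eq.trans ?_ ((N.freeStr α (Arrow.mk (N.lam f))).fill_congr rfl hd _ hs).symm
    let e : J i ⟶ Arrow.mk (N.rho (Arrow.mk (N.lam f))) := Arrow.homMk (t ≫ N.sigma f) d hs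
    change ((α i).s ≫ N.E.map s ≫ N.pi f) ≫ N.sigma f =
      (α i).s ≫ N.E.map e ≫ N.pi (Arrow.mk (N.lam f))
    have he : e = a ≫ N.toFunFact.L.map s ≫ k := by
      ext
      · exact (Category.id_comp _).symm
      · rfl
    have hσ : (α i).s ≫ N.sigma (J i) = (α i).s ≫ N.E.map a := (α i).s_sigma
    have hn := N.sigma_nat s
    have hdist : N.pi f ≫ N.sigma f = N.sigma (Arrow.mk (N.rho f)) ≫ N.E.map k ≫ _ := N.distrib f
    rw [Category.assoc, Category.assoc, hdist, reassoc_of% hn, reassoc_of% hσ, he]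
    simp only [Functor.map_comp, Category.assoc]

variable {α} in
theorem liftMap_algStr {g g' : N.monad.Algebra} (a : (N.theta J α).obj g ⟶ (N.theta J α).obj g') :
    LiftMap (N.algStr α g) (N.algStr α g') a.hom.left a.hom.right where
  comm := Arrow.w a.hom
  fill i t b h h' := (a.fill_left ⟨i, Arrow.homMk t b h⟩).trans
    (((N.theta J α).obj g').fill_congr (by ext <;> rfl))

/-- If free `R`-algebras are free lifting structures, then `R`-algebras are the same thing as
lifting structures: both are determined, in the same way, by the free ones. -/
theorem cofibrantlyGenerated_of_isFreeLift
    (hN : ∀ f, IsFreeLift (N.freeStr α f) (N.lam f)) : N.CofibrantlyGenerated J α := by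
  refine ⟨rfl, ⟨⟨fun h => Monad.Algebra.Hom.ext (congrArg RightLiftingData.Hom.hom h)⟩,
    ⟨fun {g g'} a => ?_⟩, ⟨fun g g' h => ?_, fun G => ?_⟩⟩⟩
  · have ha := N.liftMap_algStr a
    let b : g.A ⟶ g'.A := a.hom
    have h : N.E.map b ≫ act g' = act g ≫ b.left := by
      refine (hN g.A).hom_ext
        (((N.liftMap_freeStr_map α b).comp (N.liftMap_act α g')).congr rfl (Category.comp_id _))
        (((N.liftMap_act α g).comp ha).congr rfl (Category.id_comp _)) ?_
      rw [← Category.assoc, N.lam_nat, Category.assoc, lam_act, ← Category.assoc, lam_act,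
        Category.comp_id, Category.id_comp]
    refine ⟨⟨b, ?_⟩, rfl⟩
    ext
    · exact h
    · exact (congrArg (b.right ≫ ·) (N.a_right g')).trans ((Category.comp_id _).trans
        ((congrArg (· ≫ b.right) (N.a_right g)).trans (Category.id_comp _)).symm)
  · obtain ⟨A, a, hu, hs⟩ := g
    obtain ⟨A', a', hu', hs'⟩ := g'
    obtain rfl : A = A' := congrArg RightLiftingData.arrow h
    let g : N.monad.Algebra := ⟨A, a, hu, hs⟩
    let g' : N.monad.Algebra := ⟨A, a', hu', hs'⟩
    have hfill : ((N.theta J α).obj g).fill = ((N.theta J α).obj g').fill := by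
      injection h
    have hstr : LiftMap (N.algStr α g) (N.algStr α g') (𝟙 _) (𝟙 _) :=
      N.liftMap_algStr (g := g) (g' := g') ⟨𝟙 A, fun x => (Category.comp_id _).trans
        ((congrFun hfill x).trans
          (((N.theta J α).obj g').fill_congr (Category.comp_id _).symm))⟩
    have e : act g = act g' := (hN A).hom_ext
      (((N.liftMap_act α g).comp hstr).congr (Category.comp_id _) (Category.comp_id _))
      (N.liftMap_act α g') ((lam_act g).trans (lam_act g').symm)
    have e' : a = a' := by
      ext
      · exact e
      · exact (N.a_right g).trans (N.a_right g').symm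
    subst e'
    rfl
  · let H : LiftStr J G.arrow.hom :=
      { fill := fun i t b h => G.fill ⟨i, Arrow.homMk t b h⟩
        hom_fill := fun i t b h => G.hom_fill ⟨i, Arrow.homMk t b h⟩
        fill_hom := fun i t b h => G.fill_hom ⟨i, Arrow.homMk t b h⟩ }
    have w : 𝟙 _ ≫ G.arrow.hom = (N.lam G.arrow ≫ N.rho G.arrow) ≫ 𝟙 _ := by
      rw [N.fac, Category.id_comp, Category.comp_id]
    let p : N.E.obj G.arrow ⟶ G.arrow.left := (hN G.arrow).desc H (𝟙 _) (𝟙 _) w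
    have hl : N.lam G.arrow ≫ p = 𝟙 _ := (hN G.arrow).fac H _ _ w
    have hp : LiftMap (N.freeStr α G.arrow) H p (𝟙 _) := (hN G.arrow).liftMap_desc H _ _ w
    let s : Arrow.mk (N.rho G.arrow) ⟶ G.arrow := Arrow.homMk p (𝟙 _) hp.comm
    have hs : N.pi G.arrow ≫ p = N.E.map s ≫ p := by
      refine (hN _).hom_ext (((N.liftMap_freeStr_pi α G.arrow).comp hp).congr rfl
        (Category.comp_id _)) (((N.liftMap_freeStr_map α s).comp hp).congr rfl
        (Category.comp_id _)) ?_
      rw [← Category.assoc, N.lam_pi, ← Category.assoc, N.lam_nat, Category.assoc, hl]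
      exact (Category.id_comp _).trans (Category.comp_id _).symm
    have hfill (x : Squares J G.arrow) : (α x.1).s ≫ N.E.map x.2 ≫ p = G.fill x := by
      have h₀ : (x.2.left ≫ N.lam G.arrow) ≫ N.rho G.arrow = (J x.1).hom ≫ x.2.right := by
        rw [Category.assoc, N.fac, Arrow.w]
      have h₁ : ((x.2.left ≫ N.lam G.arrow) ≫ p) ≫ G.arrow.hom =
          (J x.1).hom ≫ x.2.right ≫ 𝟙 _ := by
        rw [Category.assoc, Category.assoc, reassoc_of% hl, Category.comp_id, Arrow.w]
      have h₂ : (N.freeStr α G.arrow).fill x.1 (x.2.left ≫ N.lam G.arrow) x.2.right h₀ =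
          (α x.1).s ≫ N.E.map x.2 := by
        change (α x.1).s ≫ N.E.map _ ≫ N.pi G.arrow = _
        have e : (Arrow.homMk (x.2.left ≫ N.lam G.arrow) x.2.right h₀ :
            J x.1 ⟶ Arrow.mk (N.rho G.arrow)) = x.2 ≫ N.Lambda G.arrow := by
          ext
          · rfl
          · exact (Category.comp_id _).symm
        rw [e, Functor.map_comp, Category.assoc, N.Lambda_pi, Category.comp_id]
      refine ((Category.assoc _ _ _).symm.trans (congrArg (· ≫ p) h₂.symm)).trans
        ((hp.fill _ _ _ _ h₁).trans ?_)
      refine G.fill_congr ?_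
      ext
      · exact (Category.assoc _ _ _).trans ((congrArg (_ ≫ ·) hl).trans (Category.comp_id _))
      · exact Category.comp_id _
    let g : N.monad.Algebra :=
      { A := G.arrow
        a := s
        unit := by
          ext
          · exact hl
          · exact Category.id_comp _
        assoc := by
          ext
          · exact hs
          · rfl }
    refine ⟨g, ?_⟩
    have hfill' : ((N.theta J α).obj g).fill = G.fill := funext hfill
    change (⟨G.arrow, ((N.theta J α).obj g).fill, _, _⟩ : RightLiftingData J) = G
    obtain ⟨A, fill, h₁, h₂⟩ := G
    congr

end NWFS


namespace FreeLifts

variable {C : Type u} [Category.{v} C] [HasColimits C] {ι : Type v} {J : ι → Arrow C}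
  (F : FreeLifts J) {W : Mon (DomComonad C)} (ψ : OneStep.comonad J ⟶ W.X)

/-- The lifting structure of the free algebra on `f` for a monoid under the one-step comonad. -/
noncomputable abbrev monStr (f : Arrow C) : LiftStr J (W.X.rho f) :=
  (NWFS.ofMon W).freeStr (inducedStructure ψ) f

/-- The components of the comparison map from free lifting structures to a monoid under the
one-step comonad. -/
noncomputable def toMonApp (f : Arrow C) : F.E f ⟶ W.X.E.obj f :=
  desc (monStr ψ f) (W.X.lam f) (𝟙 _) (by rw [W.X.fac, Category.comp_id])

theorem lam_toMonApp (f : Arrow C) : F.lam f ≫ F.toMonApp ψ f = W.X.lam f :=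
  lam_desc _ _ _ _

theorem liftMap_toMonApp (f : Arrow C) :
    LiftMap (F.str f) (monStr ψ f) (F.toMonApp ψ f) (𝟙 _) :=
  liftMap_desc _ _ _ _

/-- The comparison map is a map of comonads over `dom`. Compatibility with comultiplications holds
because both comultiplications are morphisms into a composite lifting structure. -/
noncomputable def toMonHom : F.comonad ⟶ W.X :=
  DomComonad.Hom.mk (A := F.comonad) (B := W.X)
  (app := F.toMonApp ψ)
  (nat := fun {f g} s =>
    hom_ext (((F.liftMap_map s).comp (F.liftMap_toMonApp ψ g)).congr rfl (Category.comp_id _))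
      (((F.liftMap_toMonApp ψ f).comp
        ((NWFS.ofMon W).liftMap_freeStr_map (inducedStructure ψ) s)).congr rfl (Category.id_comp _))
      (by
        change F.lam f ≫ F.map s ≫ F.toMonApp ψ g = F.lam f ≫ F.toMonApp ψ f ≫ W.X.E.map s
        rw [lam_map_assoc, lam_toMonApp, ← Category.assoc, lam_toMonApp, W.X.lam_nat]))
  (lam := F.lam_toMonApp ψ)
  (rho := fun f => (F.liftMap_toMonApp ψ f).comm.trans (Category.comp_id _))
  (sigma := fun f => by
    let e : Arrow.mk (F.lam f) ⟶ Arrow.mk (W.X.lam f) :=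
      Arrow.homMk (𝟙 f.left) (F.toMonApp ψ f) ((Category.id_comp _).trans (F.lam_toMonApp ψ f).symm)
    change F.toMonApp ψ f ≫ W.X.sigma f =
      F.sigma f ≫ F.map e ≫ F.toMonApp ψ (Arrow.mk (W.X.lam f))
    refine hom_ext (((F.liftMap_toMonApp ψ f).comp ((NWFS.ofMon W).liftMap_freeStr_sigma
        (inducedStructure ψ) f)).congr rfl (Category.comp_id _))
      (((F.liftMap_sigma f).comp ((((F.liftMap_map e).comp (F.liftMap_toMonApp ψ
        (Arrow.mk (W.X.lam f)))).congr (n' := F.toMonApp ψ f) rfl (Category.comp_id _)).paste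
          (F.liftMap_toMonApp ψ f))).congr rfl (Category.comp_id _)) ?_
    rw [← Category.assoc, lam_toMonApp, W.X.lam_sigma]
    refine Eq.symm ((F.lam_sigma_assoc _ _).trans ((F.lam_map_assoc e _).trans ?_))
    exact (Category.id_comp _).trans (F.lam_toMonApp ψ _))

/-- The comparison map is a morphism of monoids. -/
noncomputable def toMon : F.mon ⟶ W where
  hom := F.toMonHom ψ
  isMonHom_hom :=
    { one_hom := DomComonad.hom_ext fun f => (F.lam_toMonApp ψ f).trans (NWFS.one_app W f).symm
      mul_hom := DomComonad.hom_ext fun f => by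
        let e : Arrow.mk (F.rho f) ⟶ Arrow.mk (W.X.rho f) :=
          Arrow.homMk (F.toMonApp ψ f) (𝟙 f.right) (F.liftMap_toMonApp ψ f).comm
        have h : F.pi f ≫ F.toMonApp ψ f =
            F.map e ≫ F.toMonApp ψ (Arrow.mk (W.X.rho f)) ≫ (NWFS.ofMon W).pi f := by
          refine hom_ext ((F.liftMap_pi f).comp (F.liftMap_toMonApp ψ f))
            (((F.liftMap_map e).comp ((F.liftMap_toMonApp ψ (Arrow.mk (W.X.rho f))).comp
              ((NWFS.ofMon W).liftMap_freeStr_pi (inducedStructure ψ) f))).congr rfl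
                (Category.id_comp _)) ?_
          have hl : F.lam (Arrow.mk (W.X.rho f)) ≫ F.toMonApp ψ (Arrow.mk (W.X.rho f)) ≫
              (NWFS.ofMon W).pi f = 𝟙 _ :=
            (Category.assoc _ _ _).symm.trans ((congrArg (· ≫ (NWFS.ofMon W).pi f)
              (F.lam_toMonApp ψ _)).trans ((NWFS.ofMon W).lam_pi f))
          rw [lam_pi_assoc]
          refine Eq.symm ((F.lam_map_assoc e _).trans ?_)
          exact (congrArg (F.toMonApp ψ f ≫ ·) hl).trans (Category.comp_id _)
        exact h.trans (Category.assoc _ _ _).symm }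

theorem fromOneStep_toMon : F.fromOneStep ≫ (F.toMon ψ).hom = ψ :=
  DomComonad.hom_ext fun f => by
    let ψ' (f) : OneStep.obj J f ⟶ W.X.E.obj f := DomComonad.Hom.app ψ f
    have hψ : OneStep.lam J f ≫ ψ' f = W.X.lam f := DomComonad.Hom.lam ψ f
    change F.fromOneStepApp f ≫ F.toMonApp ψ f = ψ' f
    refine OneStep.hom_ext J ?_ fun x => ?_
    · rw [← Category.assoc, lam_fromOneStepApp, lam_toMonApp, hψ]
    · have h : ((x.2.left ≫ F.lam f) ≫ F.toMonApp ψ f) ≫ W.X.rho f =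
          (J x.1).hom ≫ x.2.right ≫ 𝟙 _ := by
        rw [Category.assoc, Category.assoc, (F.liftMap_toMonApp ψ f).comm,
          reassoc_of% F.fac, Category.comp_id, Category.comp_id, Arrow.w]
      rw [← Category.assoc, cell_fromOneStepApp, (F.liftMap_toMonApp ψ f).fill _ _ _ _ h]
      have e : (Arrow.homMk ((x.2.left ≫ F.lam f) ≫ F.toMonApp ψ f) (x.2.right ≫ 𝟙 _) h :
          J x.1 ⟶ Arrow.mk (W.X.rho f)) = x.2 ≫ W.X.Lambda f := by
        ext
        · exact (Category.assoc _ _ _).trans (congrArg (x.2.left ≫ ·) (F.lam_toMonApp ψ f))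
        · rfl
      let π : W.X.E.obj (Arrow.mk (W.X.rho f)) ⟶ W.X.E.obj f := (NWFS.ofMon W).pi f
      have hn : OneStep.map J x.2 ≫ ψ' f = ψ' (J x.1) ≫ W.X.E.map x.2 :=
        DomComonad.Hom.nat ψ x.2
      have hΛ : W.X.E.map (W.X.Lambda f) ≫ π = 𝟙 _ := (NWFS.ofMon W).Lambda_pi f
      let c := OneStep.cell J (⟨x.1, 𝟙 (J x.1)⟩ : Squares J (J x.1))
      have hc : c ≫ OneStep.map J x.2 = OneStep.cell J x :=
        OneStep.cell_map' J _ _ _ (Category.id_comp _)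
      refine (congrArg (fun s => (c ≫ ψ' (J x.1)) ≫ W.X.E.map s ≫ π) e).trans ?_
      rw [Functor.map_comp, Category.assoc, Category.assoc, hΛ, Category.comp_id, ← hn,
        ← Category.assoc, hc]

/-- A morphism of monoids from a monoid under the one-step comonad to the free lifting structures
preserves lifting structures. -/
theorem liftMap_of_monHom (φ : W ⟶ F.mon) (hφ : ψ ≫ φ.hom = F.fromOneStep) (f : Arrow C) :
    LiftMap (monStr ψ f) (F.str f) (DomComonad.Hom.app φ.hom f) (𝟙 _) where
  comm := (DomComonad.Hom.rho φ.hom f).trans (Category.comp_id _).symm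
  fill i t b h h' := by
    let s : J i ⟶ Arrow.mk (W.X.rho f) := Arrow.homMk t b h
    let e : Arrow.mk (W.X.rho f) ⟶ Arrow.mk (F.rho f) := DomComonad.Hom.mapR φ.hom f
    let φ' (f) : W.X.E.obj f ⟶ F.E f := DomComonad.Hom.app φ.hom f
    let π : W.X.E.obj (Arrow.mk (W.X.rho f)) ⟶ W.X.E.obj f := (NWFS.ofMon W).pi f
    let β : (J i).right ⟶ W.X.E.obj (J i) := (inducedStructure ψ i).s
    have hmul : π ≫ φ' f =
        W.X.E.map e ≫ φ' (Arrow.mk (F.rho f)) ≫ F.pi f :=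
      (congrArg (fun t => DomComonad.Hom.app t f) (IsMonHom.mul_hom φ.hom)).trans
        (Category.assoc _ _ _)
    have hn {f g : Arrow C} (s : f ⟶ g) : W.X.E.map s ≫ φ' g = φ' f ≫ F.map s :=
      DomComonad.Hom.nat φ.hom s
    have hβ : β ≫ φ' (J i) =
        (F.str (J i)).fill i (𝟙 _ ≫ F.lam (J i)) (𝟙 _)
          (by rw [Category.id_comp, F.fac, Category.comp_id]) := by
      refine (Category.assoc _ _ _).trans (Eq.trans ?_ (F.cell_fromOneStepApp (⟨i, 𝟙 (J i)⟩ : Squares J (J i))))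
      exact congrArg (OneStep.cell J _ ≫ ·) (congrArg (fun t => DomComonad.Hom.app t (J i)) hφ)
    have hl : (𝟙 _ ≫ F.lam (J i)) ≫ F.map (s ≫ e) ≫ F.pi f = t ≫ φ' f := by
      rw [Category.id_comp, lam_map_assoc]
      exact (congrArg (_ ≫ ·) (F.lam_pi f)).trans (Category.comp_id _)
    have hr : 𝟙 _ ≫ (s ≫ e).right ≫ 𝟙 _ = b ≫ 𝟙 _ := by
      rw [Category.id_comp, Category.comp_id]; rfl
    have k := ((F.liftMap_map (s ≫ e)).comp (F.liftMap_pi f)).fill i (𝟙 _ ≫ F.lam (J i)) (𝟙 _)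
      (by rw [Category.id_comp, F.fac, Category.comp_id]) (by
        rw [hl]; exact h'.trans (congrArg ((J i).hom ≫ ·) hr.symm))
    have hs : (β ≫ W.X.E.map s ≫ π) ≫ φ' f =
        (β ≫ φ' (J i)) ≫ F.map (s ≫ e) ≫ F.pi f := by
      rw [Category.assoc, Category.assoc, hmul, ← Functor.map_comp_assoc, reassoc_of% hn (s ≫ e),
        Category.assoc]
    refine hs.trans ((congrArg (· ≫ F.map (s ≫ e) ≫ F.pi f) hβ).trans ?_)
    exact k.trans ((F.str f).fill_congr hl hr _ _)

/-- The free monoid on the one-step comonad is the monoid of free lifting structures, so its free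
algebras are free lifting structures. -/
theorem isFreeLift_of_isFreeMonoid (F : FreeLifts J) {U : Mon (DomComonad C)} {χ : OneStep.comonad J ⟶ U.X}
    (hU : IsFreeMonoid (oneStepPoint J) U χ) (f : Arrow C) :
    IsFreeLift (monStr χ f) (U.X.lam f) := by
  obtain ⟨φ, hφ, -⟩ := hU.existsUnique F.mon F.fromOneStep F.point_fromOneStep
  have h₁ : φ ≫ F.toMon χ = 𝟙 U := by
    refine (hU.existsUnique U χ hU.point).unique ?_ (Category.comp_id χ)
    change χ ≫ φ.hom ≫ (F.toMon χ).hom = χ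
    rw [← Category.assoc, hφ]
    exact F.fromOneStep_toMon χ
  let φ' : U.X.E.obj f ⟶ F.E f := DomComonad.Hom.app φ.hom f
  have h₂ : φ' ≫ F.toMonApp χ f = 𝟙 _ :=
    congrArg (fun t : U ⟶ U => DomComonad.Hom.app t.hom f) h₁
  have hl : U.X.lam f ≫ φ' = F.lam f := DomComonad.Hom.lam φ.hom f
  have hm := F.liftMap_of_monHom χ φ hφ f
  intro Z W g H t b w
  have w' : t ≫ g = f.hom ≫ b := by rw [w, U.X.fac]
  refine ⟨φ' ≫ F.desc H t b w',
    ⟨by rw [← Category.assoc, hl]; exact F.lam_desc H t b w',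
      (hm.comp (F.liftMap_desc H t b w')).congr rfl (Category.id_comp _)⟩, ?_⟩
  rintro m ⟨hm₁, hm₂⟩
  have key : F.toMonApp χ f ≫ m = F.desc H t b w' :=
    hom_ext (((F.liftMap_toMonApp χ f).comp hm₂).congr rfl (Category.id_comp _))
      (F.liftMap_desc H t b w') (by
        rw [← Category.assoc, lam_toMonApp, hm₁]; exact (F.lam_desc H t b w').symm)
  rw [← key, ← Category.assoc, h₂, Category.id_comp]

end FreeLifts


/-! ### Connected colimits of comonads over `dom` -/

namespace DomComonad

universe v' u'

variable {C : Type u} [Category.{v} C]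

/-- Evaluation of the middle object of a factorisation at an arrow `f`. -/
def ev (f : Arrow C) : DomComonad C ⥤ C where
  obj A := A.E.obj f
  map a := Hom.app a f

section ConnectedColimit

variable {K : Type u'} [Category.{v'} K] [HasColimitsOfShape K C]
  (F : K ⥤ DomComonad C)

/-- The colimit of the middle objects at `f`. -/
noncomputable abbrev colimObj (f : Arrow C) : C := colimit (F ⋙ ev f)

/-- The legs of the pointwise colimit. -/
noncomputable def colimLeg (k : K) (f : Arrow C) : (F.obj k).E.obj f ⟶ colimObj F f :=
  colimit.ι (F ⋙ ev f) k

theorem colimLeg_w {k k' : K} (h : k ⟶ k') (f : Arrow C) :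
    Hom.app (F.map h) f ≫ colimLeg F k' f = colimLeg F k f :=
  colimit.w (F ⋙ ev f) h

theorem colim_hom_ext {f : Arrow C} {Z : C} {a b : colimObj F f ⟶ Z}
    (h : ∀ k, colimLeg F k f ≫ a = colimLeg F k f ≫ b) : a = b := colimit.hom_ext h

/-- The universal property of the pointwise colimit. -/
noncomputable def colimDesc {f : Arrow C} {Z : C} (a : ∀ k, (F.obj k).E.obj f ⟶ Z)
    (h : ∀ k k' (u : k ⟶ k'), Hom.app (F.map u) f ≫ a k' = a k) : colimObj F f ⟶ Z :=
  colimit.desc (F ⋙ ev f)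
    { pt := Z
      ι := { app := a, naturality := fun _ _ u => (h _ _ u).trans (Category.comp_id _).symm } }

theorem colimLeg_desc {f : Arrow C} {Z : C} (a : ∀ k, (F.obj k).E.obj f ⟶ Z)
    (h : ∀ k k' (u : k ⟶ k'), Hom.app (F.map u) f ≫ a k' = a k) (k : K) :
    colimLeg F k f ≫ colimDesc F a h = a k := colimit.ι_desc _ _

/-- Functoriality in `f` of the pointwise colimit. -/
noncomputable def colimMap {f g : Arrow C} (s : f ⟶ g) : colimObj F f ⟶ colimObj F g :=
  colimDesc F (fun k => (F.obj k).E.map s ≫ colimLeg F k g) (fun k k' u => by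
    rw [← reassoc_of% Hom.nat (F.map u) s, colimLeg_w])

theorem colimLeg_map (k : K) {f g : Arrow C} (s : f ⟶ g) :
    colimLeg F k f ≫ colimMap F s = (F.obj k).E.map s ≫ colimLeg F k g :=
  colimLeg_desc _ _ _ _

theorem colimLeg_map_assoc (k : K) {f g : Arrow C} (s : f ⟶ g) {Z : C} (z : colimObj F g ⟶ Z) :
    colimLeg F k f ≫ colimMap F s ≫ z = (F.obj k).E.map s ≫ colimLeg F k g ≫ z := by
  rw [← Category.assoc, colimLeg_map, Category.assoc]

/-- The map `ρ` out of the pointwise colimit. -/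
noncomputable def colimRho (f : Arrow C) : colimObj F f ⟶ f.right :=
  colimDesc F (fun k => (F.obj k).rho f) (fun _ _ u => Hom.rho (F.map u) f)

theorem colimLeg_rho (k : K) (f : Arrow C) : colimLeg F k f ≫ colimRho F f = (F.obj k).rho f :=
  colimLeg_desc _ _ _ _

theorem colimLeg_rho_assoc (k : K) (f : Arrow C) {Z : C} (z : f.right ⟶ Z) :
    colimLeg F k f ≫ colimRho F f ≫ z = (F.obj k).rho f ≫ z := by
  rw [← Category.assoc, colimLeg_rho]

section

variable {F} (c : Cocone F)

/-- The components of the map from the pointwise colimit to a cocone. -/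
noncomputable def colimDescApp (f : Arrow C) : colimObj F f ⟶ c.pt.E.obj f :=
  colimDesc F (fun k => Hom.app (c.ι.app k) f)
    (fun _ _ u => congrArg (fun t => Hom.app t f) (c.w u))

theorem colimLeg_descApp (k : K) (f : Arrow C) :
    colimLeg F k f ≫ colimDescApp c f = Hom.app (c.ι.app k) f :=
  colimLeg_desc _ _ _ _

theorem colimLeg_descApp_assoc (k : K) (f : Arrow C) {Z : C} (z : c.pt.E.obj f ⟶ Z) :
    colimLeg F k f ≫ colimDescApp c f ≫ z = Hom.app (c.ι.app k) f ≫ z := by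
  rw [← Category.assoc, colimLeg_descApp]

end

variable [IsConnected K]

/-- The map `λ` into the pointwise colimit, through an arbitrarily chosen leg. -/
noncomputable def colimLam (f : Arrow C) : f.left ⟶ colimObj F f :=
  (F.obj (Classical.arbitrary K)).lam f ≫ colimLeg F _ f

/-- As the diagram is connected, `λ` factors through every leg. -/
theorem lam_colimLeg (k : K) (f : Arrow C) : (F.obj k).lam f ≫ colimLeg F k f = colimLam F f :=
  constant_of_preserves_morphisms (fun k => (F.obj k).lam f ≫ colimLeg F k f)
    (fun k k' u => by
      rw [← colimLeg_w F u, ← Hom.lam (F.map u), Category.assoc]) _ _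

/-- The square `(1, κ_k) : λ_k ⟶ λ` for the leg `κ_k` of the pointwise colimit. -/
noncomputable abbrev colimLegL (k : K) (f : Arrow C) :
    Arrow.mk ((F.obj k).lam f) ⟶ Arrow.mk (colimLam F f) :=
  Arrow.homMk (𝟙 f.left) (colimLeg F k f)
    ((Category.id_comp _).trans (lam_colimLeg F k f).symm)

/-- The comultiplication on the pointwise colimit. -/
noncomputable def colimSigma (f : Arrow C) :
    colimObj F f ⟶ colimObj F (Arrow.mk (colimLam F f)) :=
  colimDesc F (fun k => (F.obj k).sigma f ≫ (F.obj k).E.map (colimLegL F k f) ≫ colimLeg F k _)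
    (fun k k' u => by
      have e : Hom.mapL (F.map u) f ≫ colimLegL F k' f = colimLegL F k f := by
        ext
        · exact Category.id_comp _
        · exact colimLeg_w F u f
      rw [reassoc_of% Hom.sigma' (F.map u) f, ← reassoc_of% Hom.nat (F.map u) (colimLegL F k' f),
        colimLeg_w, ← Functor.map_comp_assoc, e])

theorem colimLeg_sigma (k : K) (f : Arrow C) : colimLeg F k f ≫ colimSigma F f =
    (F.obj k).sigma f ≫ (F.obj k).E.map (colimLegL F k f) ≫ colimLeg F k _ :=
  colimLeg_desc _ _ _ _

theorem colimLeg_sigma_assoc (k : K) (f : Arrow C) {Z : C}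
    (z : colimObj F (Arrow.mk (colimLam F f)) ⟶ Z) : colimLeg F k f ≫ colimSigma F f ≫ z =
      (F.obj k).sigma f ≫ (F.obj k).E.map (colimLegL F k f) ≫ colimLeg F k _ ≫ z := by
  rw [← Category.assoc, colimLeg_sigma, Category.assoc, Category.assoc]

theorem lam_colimSigma (f : Arrow C) :
    colimLam F f ≫ colimSigma F f = colimLam F (Arrow.mk (colimLam F f)) := by
  let k : K := Classical.arbitrary K
  refine (congrArg (· ≫ colimSigma F f) (lam_colimLeg F k f).symm).trans ?_
  rw [Category.assoc, colimLeg_sigma, reassoc_of% (F.obj k).lam_sigma f]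
  refine (Category.assoc _ _ _).symm.trans ((congrArg (· ≫ _)
    ((F.obj k).lam_nat (colimLegL F k f))).trans ?_)
  exact (congrArg (· ≫ _) (Category.id_comp _)).trans (lam_colimLeg F k _)

/-- The functorial factorisation on pointwise connected colimits. -/
noncomputable abbrev colimFact : FunFact C where
  E :=
    { obj := colimObj F
      map := colimMap F
      map_id := fun f => colim_hom_ext F fun k => by
        rw [colimLeg_map, CategoryTheory.Functor.map_id, Category.id_comp, Category.comp_id]
      map_comp := fun s t => colim_hom_ext F fun k => by
        rw [colimLeg_map, colimLeg_map_assoc, colimLeg_map, Functor.map_comp, Category.assoc] }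
  lam := colimLam F
  rho := colimRho F
  lam_nat s := by
    let k : K := Classical.arbitrary K
    change colimLam F _ ≫ colimMap F s = s.left ≫ colimLam F _
    rw [← lam_colimLeg F k, ← lam_colimLeg F k, Category.assoc, colimLeg_map,
      reassoc_of% (F.obj k).lam_nat s]
  rho_nat s := colim_hom_ext F fun k => by
    change colimLeg F k _ ≫ colimMap F s ≫ colimRho F _ = colimLeg F k _ ≫ colimRho F _ ≫ s.right
    rw [colimLeg_map_assoc, colimLeg_rho, colimLeg_rho_assoc, (F.obj k).rho_nat]
  fac f := by
    let k : K := Classical.arbitrary K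
    rw [← lam_colimLeg F k, Category.assoc, colimLeg_rho, (F.obj k).fac]

/-- Connected colimits of comonads over `dom` are computed pointwise. Connectedness makes the maps
`λ` of the diagram agree in the colimit. -/
noncomputable def colimComonad : DomComonad C where
  toFunFact := colimFact F
  sigma := colimSigma F
  lam_sigma := lam_colimSigma F
  sigma_nat {f g} s := colim_hom_ext F fun k => by
    let Ls : Arrow.mk (colimLam F f) ⟶ Arrow.mk (colimLam F g) := (colimFact F).L.map s
    change colimLeg F k f ≫ colimMap F s ≫ colimSigma F g =
      colimLeg F k f ≫ colimSigma F f ≫ colimMap F Ls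
    have e : (F.obj k).L.map s ≫ colimLegL F k g = colimLegL F k f ≫ Ls := by
      ext
      · exact (Category.comp_id _).trans (Category.id_comp _).symm
      · exact (colimLeg_map F k s).symm
    rw [colimLeg_map_assoc, colimLeg_sigma, colimLeg_sigma_assoc, colimLeg_map,
      reassoc_of% (F.obj k).sigma_nat s, ← Functor.map_comp_assoc, e, Functor.map_comp_assoc]
  sigma_rho f := colim_hom_ext F fun k => by
    change colimLeg F k f ≫ colimSigma F f ≫ colimRho F (Arrow.mk (colimLam F f)) =
      colimLeg F k f ≫ 𝟙 _
    rw [colimLeg_sigma_assoc, colimLeg_rho, (F.obj k).rho_nat]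
    exact (Category.assoc _ _ _).symm.trans ((congrArg (· ≫ colimLeg F k f)
      ((F.obj k).sigma_rho f)).trans ((Category.id_comp _).trans (Category.comp_id _).symm))
  sigma_Phi f := colim_hom_ext F fun k => by
    let P : Arrow.mk (colimLam F f) ⟶ f := (colimFact F).Phi f
    change colimLeg F k f ≫ colimSigma F f ≫ colimMap F P = colimLeg F k f ≫ 𝟙 _
    have e : colimLegL F k f ≫ P = (F.obj k).Phi f := by
      ext
      · exact Category.id_comp _
      · exact colimLeg_rho F k f
    rw [colimLeg_sigma_assoc, colimLeg_map, ← Functor.map_comp_assoc, e,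
      reassoc_of% (F.obj k).sigma_Phi f, Category.comp_id]
  coassoc f := colim_hom_ext F fun k => by
    let S : Arrow.mk (colimLam F f) ⟶ Arrow.mk (colimLam F (Arrow.mk (colimLam F f))) :=
      Arrow.homMk (𝟙 f.left) (colimSigma F f)
        ((Category.id_comp _).trans (lam_colimSigma F f).symm)
    change colimLeg F k f ≫ colimSigma F f ≫ colimMap F S =
      colimLeg F k f ≫ colimSigma F f ≫ colimSigma F (Arrow.mk (colimLam F f))
    have e : colimLegL F k f ≫ S = (F.obj k).Sig f ≫ (F.obj k).L.map (colimLegL F k f) ≫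
        colimLegL F k (Arrow.mk (colimLam F f)) := by
      ext
      · exact (congrArg (𝟙 f.left ≫ ·) (Category.id_comp _)).symm
      · exact colimLeg_sigma F k f
    rw [colimLeg_sigma_assoc, colimLeg_sigma_assoc, colimLeg_map, colimLeg_sigma,
      ← Functor.map_comp_assoc, e, reassoc_of% (F.obj k).sigma_nat (colimLegL F k f),
      ← reassoc_of% (F.obj k).coassoc' f]
    simp only [Functor.map_comp, Category.assoc]

/-- The colimit cocone of a connected diagram of comonads over `dom`. -/
noncomputable def colimCocone : Cocone F where
  pt := colimComonad F
  ι :=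
    { app := fun k => Hom.mk (A := F.obj k) (B := colimComonad F)
        (app := colimLeg F k)
        (nat := fun s => (colimLeg_map F k s).symm)
        (lam := lam_colimLeg F k)
        (rho := colimLeg_rho F k)
        (sigma := colimLeg_sigma F k)
      naturality := fun _ _ u => hom_ext fun f =>
        (colimLeg_w F u f).trans (Category.comp_id _).symm }

section Desc

variable {F} (c : Cocone F)

theorem colimLam_descApp (f : Arrow C) : colimLam F f ≫ colimDescApp c f = c.pt.lam f := by
  rw [← lam_colimLeg F (Classical.arbitrary K), Category.assoc, colimLeg_descApp]
  exact Hom.lam _ _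

/-- The map of comonads over `dom` from the pointwise colimit to a cocone. -/
noncomputable def colimDescHom : colimComonad F ⟶ c.pt :=
  Hom.mk (A := colimComonad F) (B := c.pt)
  (app := colimDescApp c)
  (nat := fun {f g} s => colim_hom_ext F fun k => by
    change colimLeg F k f ≫ colimMap F s ≫ colimDescApp c g =
      colimLeg F k f ≫ colimDescApp c f ≫ c.pt.E.map s
    rw [colimLeg_map_assoc, colimLeg_descApp, colimLeg_descApp_assoc]
    exact Hom.nat (c.ι.app k) s)
  (lam := colimLam_descApp c)
  (rho := fun f => colim_hom_ext F fun k => by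
    change colimLeg F k f ≫ colimDescApp c f ≫ c.pt.rho f = colimLeg F k f ≫ colimRho F f
    rw [colimLeg_descApp_assoc, colimLeg_rho]
    exact Hom.rho (c.ι.app k) f)
  (sigma := fun f => colim_hom_ext F fun k => by
    let e : Arrow.mk (colimLam F f) ⟶ Arrow.mk (c.pt.lam f) :=
      Arrow.homMk (𝟙 f.left) (colimDescApp c f)
        ((Category.id_comp _).trans (colimLam_descApp c f).symm)
    change colimLeg F k f ≫ colimDescApp c f ≫ c.pt.sigma f =
      colimLeg F k f ≫ colimSigma F f ≫ colimMap F e ≫ colimDescApp c _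
    have he : colimLegL F k f ≫ e = Hom.mapL (c.ι.app k) f := by
      ext
      · exact Category.id_comp _
      · exact colimLeg_descApp c k f
    rw [colimLeg_descApp_assoc, colimLeg_sigma_assoc, colimLeg_map_assoc, colimLeg_descApp,
      ← Functor.map_comp_assoc, he]
    exact Hom.sigma' (c.ι.app k) f)

end Desc

noncomputable def isColimitColimCocone : IsColimit (colimCocone F) where
  desc c := colimDescHom c
  fac c k := hom_ext fun f => colimLeg_descApp c k f
  uniq c _ hm := hom_ext fun f => colim_hom_ext F fun k =>
    (congrArg (fun t => Hom.app t f) (hm k)).trans (colimLeg_descApp c k f).symm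

instance hasColimitsOfShape : HasColimitsOfShape K (DomComonad C) where
  has_colimit F := ⟨⟨colimCocone F, isColimitColimCocone F⟩⟩

instance ev_preservesColimitsOfShape (f : Arrow C) : PreservesColimitsOfShape K (ev f) where
  preservesColimit {F} := preservesColimit_of_preserves_colimit_cocone (isColimitColimCocone F)
    (IsColimit.ofIsoColimit (colimit.isColimit (F ⋙ ev f)) (Cocone.ext (Iso.refl _)
      (fun _ => Category.comp_id _)))

end ConnectedColimit

end DomComonad


/-! ### Free lifting structures from a convergent transfinite sequence -/

namespace LiftStr

variable {C : Type u} [Category.{v} C] [HasColimits C] {ι : Type v} {J : ι → Arrow C}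

section Extend

variable {E Y Z W : C} {r : E ⟶ Y} {g : Z ⟶ W} (H : LiftStr J g)

/-- The composite of `E¹(m, n) : E¹ r ⟶ E¹ g` with the algebra structure `E¹ g ⟶ Z` for the
pointed endofunctor `R¹` corresponding to the lifting structure `H`. -/
noncomputable def extend (m : E ⟶ Z) (n : Y ⟶ W) (w : m ≫ g = r ≫ n) :
    OneStep.obj J (Arrow.mk r) ⟶ Z :=
  OneStep.desc J m
    (fun x => H.fill x.1 (x.2.left ≫ m) (x.2.right ≫ n)
      (by rw [Category.assoc, w]; exact Arrow.w_assoc x.2 n))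
    (fun _ => H.hom_fill _ _ _ _)

theorem lam_extend (m : E ⟶ Z) (n : Y ⟶ W) (w : m ≫ g = r ≫ n) :
    OneStep.lam J (Arrow.mk r) ≫ H.extend m n w = m := OneStep.lam_desc _ _ _ _

theorem cell_extend (m : E ⟶ Z) (n : Y ⟶ W) (w : m ≫ g = r ≫ n)
    (x : Squares J (Arrow.mk r)) : OneStep.cell J x ≫ H.extend m n w =
      H.fill x.1 (x.2.left ≫ m) (x.2.right ≫ n)
        (by rw [Category.assoc, w]; exact Arrow.w_assoc x.2 n) := OneStep.cell_desc _ _ _ _ _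

theorem extend_hom (m : E ⟶ Z) (n : Y ⟶ W) (w : m ≫ g = r ≫ n) :
    H.extend m n w ≫ g = OneStep.rho J (Arrow.mk r) ≫ n := by
  refine OneStep.hom_ext J ?_ fun x => ?_
  · rw [← Category.assoc, lam_extend, ← Category.assoc, OneStep.lam_rho]
    exact w
  · rw [← Category.assoc, cell_extend, fill_hom, ← Category.assoc, OneStep.cell_rho]

theorem extend_congr {m m' : E ⟶ Z} {n : Y ⟶ W} (h : m = m') (w : m ≫ g = r ≫ n)
    (w' : m' ≫ g = r ≫ n) : H.extend m n w = H.extend m' n w' := by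
  subst h; rfl

theorem map_extend {E' : C} {r' : E' ⟶ Y} (s : Arrow.mk r' ⟶ Arrow.mk r) (hs : s.right = 𝟙 Y)
    (m : E ⟶ Z) (n : Y ⟶ W) (w : m ≫ g = r ≫ n) (w' : (s.left ≫ m) ≫ g = r' ≫ n) :
    OneStep.map J s ≫ H.extend m n w = H.extend (s.left ≫ m) n w' := by
  refine OneStep.hom_ext J ?_ fun x => ?_
  · rw [← Category.assoc, OneStep.lam_map, Category.assoc, lam_extend, lam_extend]
  · rw [← Category.assoc, OneStep.cell_map, cell_extend, cell_extend]
    refine H.fill_congr (Category.assoc _ _ _) ?_ _ _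
    exact congrArg (· ≫ n) ((congrArg (x.2.right ≫ ·) hs).trans (Category.comp_id _))

end Extend

/-- The lifting structure on `g` corresponding to an algebra `p : E¹ g ⟶ dom g` for the pointed
endofunctor `R¹`. -/
noncomputable def ofAct {Z W : C} {g : Z ⟶ W} (p : OneStep.obj J (Arrow.mk g) ⟶ Z)
    (hl : OneStep.lam J (Arrow.mk g) ≫ p = 𝟙 Z) (hr : p ≫ g = OneStep.rho J (Arrow.mk g)) :
    LiftStr J g where
  fill i t b h := OneStep.cell J (⟨i, Arrow.homMk t b h⟩ : Squares J (Arrow.mk g)) ≫ p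
  hom_fill i t b h := by
    refine (Category.assoc _ _ _).symm.trans ((congrArg (· ≫ p) (OneStep.cell_comm J
      (⟨i, Arrow.homMk t b h⟩ : Squares J (Arrow.mk g)))).trans ((Category.assoc _ _ _).trans ?_))
    exact (congrArg (t ≫ ·) hl).trans (Category.comp_id _)
  fill_hom i t b h := by
    rw [Category.assoc, hr, OneStep.cell_rho]
    rfl

/-- A morphism out of the lifting structure of an `R¹`-algebra is a morphism of `R¹`-algebras. -/
theorem liftMap_ofAct_iff {Z W Z' W' : C} {g : Z ⟶ W} {p : OneStep.obj J (Arrow.mk g) ⟶ Z}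
    (hl : OneStep.lam J (Arrow.mk g) ≫ p = 𝟙 Z) (hr : p ≫ g = OneStep.rho J (Arrow.mk g))
    {g' : Z' ⟶ W'} (H : LiftStr J g') {m : Z ⟶ Z'} {n : W ⟶ W'} (w : m ≫ g' = g ≫ n) :
    LiftMap (ofAct p hl hr) H m n ↔ p ≫ m = H.extend m n w := by
  constructor
  · intro a
    refine OneStep.hom_ext J ?_ fun x => ?_
    · rw [← Category.assoc, hl, lam_extend]
      exact Category.id_comp m
    · rw [cell_extend, ← Category.assoc]
      exact a.fill x.1 x.2.left x.2.right (Arrow.w x.2) _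
  · intro h
    refine ⟨w, fun i t b h₁ h₂ => ?_⟩
    change (OneStep.cell J _ ≫ p) ≫ m = _
    rw [Category.assoc, h, cell_extend]
    rfl

end LiftStr

/-- The value at one arrow `f` of a free module sequence for the one-step comonad: a transfinite
sequence of factorisations of `f` with actions `E¹ ρ_a ⟶ E_{a⁺}`, subject to the pointwise
universal properties. -/
structure PointwiseSequence {C : Type u} [Category.{v} C] [HasColimits C] {ι : Type v}
    (J : ι → Arrow C) (f : Arrow C) where
  E : Ordinal.{v} ⥤ C
  lam (a : Ordinal.{v}) : f.left ⟶ E.obj a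
  rho (a : Ordinal.{v}) : E.obj a ⟶ f.right
  lam_map {a b : Ordinal.{v}} (h : a ≤ b) : lam a ≫ E.map (homOfLE h) = lam b
  map_rho {a b : Ordinal.{v}} (h : a ≤ b) : E.map (homOfLE h) ≫ rho b = rho a
  fac (a : Ordinal.{v}) : lam a ≫ rho a = f.hom
  act (a : Ordinal.{v}) : OneStep.obj J (Arrow.mk (rho a)) ⟶ E.obj (Order.succ a)
  lam_act (a : Ordinal.{v}) :
    OneStep.lam J (Arrow.mk (rho a)) ≫ act a = E.map (homOfLE (Order.le_succ a))
  act_rho (a : Ordinal.{v}) : act a ≫ rho (Order.succ a) = OneStep.rho J (Arrow.mk (rho a))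
  act_nat {a b : Ordinal.{v}} (h : a ≤ b) :
    OneStep.map J (Arrow.homMk (E.map (homOfLE h)) (𝟙 _)
      ((map_rho h).trans (Category.comp_id _).symm) : Arrow.mk (rho a) ⟶ Arrow.mk (rho b)) ≫ act b =
        act a ≫ E.map (homOfLE (Order.succ_le_succ h))
  isIso_lam_zero : IsIso (lam 0)
  existsUnique_act (a : Ordinal.{v}) {Z : C} (k : OneStep.obj J (Arrow.mk (rho a)) ⟶ Z)
    (hk : ∀ (b : Ordinal.{v}) (h : b < a),
      act b ≫ E.map (homOfLE (Order.succ_le_of_lt h)) ≫ OneStep.lam J (Arrow.mk (rho a)) ≫ k =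
        OneStep.map J (Arrow.homMk (E.map (homOfLE h.le)) (𝟙 _)
          ((map_rho h.le).trans (Category.comp_id _).symm) :
            Arrow.mk (rho b) ⟶ Arrow.mk (rho a)) ≫ k) :
    ∃! l : E.obj (Order.succ a) ⟶ Z, act a ≫ l = k
  existsUnique_limit (c : Ordinal.{v}) (hc : Order.IsSuccLimit c) {Z : C}
    (k : ∀ a < c, E.obj a ⟶ Z)
    (hk : ∀ (a b : Ordinal.{v}) (h : a ≤ b) (hb : b < c),
      E.map (homOfLE h) ≫ k b hb = k a (h.trans_lt hb)) :
    ∃! l : E.obj c ⟶ Z, ∀ (a : Ordinal.{v}) (h : a < c), E.map (homOfLE h.le) ≫ l = k a h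

namespace PointwiseSequence

variable {C : Type u} [Category.{v} C] [HasColimits C] {ι : Type v} {J : ι → Arrow C}
  {f : Arrow C} (S : PointwiseSequence J f)

theorem map_map {a b c : Ordinal.{v}} (h : a ≤ b) (h' : b ≤ c) :
    S.E.map (homOfLE h) ≫ S.E.map (homOfLE h') = S.E.map (homOfLE (h.trans h')) := by
  rw [← Functor.map_comp]; rfl

theorem map_map_assoc {a b c : Ordinal.{v}} (h : a ≤ b) (h' : b ≤ c) {Z : C}
    (k : S.E.obj c ⟶ Z) : S.E.map (homOfLE h) ≫ S.E.map (homOfLE h') ≫ k =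
      S.E.map (homOfLE (h.trans h')) ≫ k := by
  rw [← Category.assoc, map_map]

theorem map_refl {a : Ordinal.{v}} (h : a ≤ a) : S.E.map (homOfLE h) = 𝟙 _ :=
  S.E.map_id a

/-- The square `(E_a ⟶ E_b, 1) : ρ_a ⟶ ρ_b`. -/
noncomputable abbrev sq {a b : Ordinal.{v}} (h : a ≤ b) :
    Arrow.mk (S.rho a) ⟶ Arrow.mk (S.rho b) :=
  Arrow.homMk (S.E.map (homOfLE h)) (𝟙 _) ((S.map_rho h).trans (Category.comp_id _).symm)

section Extension

variable {Z W : C} {g : Z ⟶ W} (H : LiftStr J g) (t : f.left ⟶ Z) (n : f.right ⟶ W)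

/-- A stage-`a` approximation to the extension of a square `(t, n) : f ⟶ g` along the unit of the
free lifting structure: a map `m : E_a ⟶ Z` that is compatible with all actions below `a`. -/
structure IsExtension (a : Ordinal.{v}) (m : S.E.obj a ⟶ Z) : Prop where
  comm : m ≫ g = S.rho a ≫ n
  lam : S.lam a ≫ m = t
  act (b : Ordinal.{v}) (h : b < a)
    (w : (S.E.map (homOfLE h.le) ≫ m) ≫ g = S.rho b ≫ n) :
    S.act b ≫ S.E.map (homOfLE (Order.succ_le_of_lt h)) ≫ m =
      H.extend (S.E.map (homOfLE h.le) ≫ m) n w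

variable {S H t n}

namespace IsExtension

theorem comm_restrict {a b : Ordinal.{v}} {m : S.E.obj b ⟶ Z} (hm : m ≫ g = S.rho b ≫ n)
    (h : a ≤ b) : (S.E.map (homOfLE h) ≫ m) ≫ g = S.rho a ≫ n := by
  rw [Category.assoc, hm, ← Category.assoc, S.map_rho]

theorem restrict {a b : Ordinal.{v}} {m : S.E.obj b ⟶ Z} (hm : S.IsExtension H t n b m)
    (h : a ≤ b) : S.IsExtension H t n a (S.E.map (homOfLE h) ≫ m) where
  comm := comm_restrict hm.comm h
  lam := by rw [← Category.assoc, S.lam_map, hm.lam]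
  act c hc w := by
    rw [S.map_map_assoc, hm.act c (hc.trans_le h) (comm_restrict hm.comm _)]
    exact H.extend_congr (S.map_map_assoc _ _ _).symm _ _

/-- Restriction along the sequence commutes with extension to `E¹`. -/
theorem map_sq_extend {a b : Ordinal.{v}} {m : S.E.obj b ⟶ Z} (hm : m ≫ g = S.rho b ≫ n)
    (h : a ≤ b) : OneStep.map J (S.sq h) ≫ H.extend m n hm =
      H.extend (S.E.map (homOfLE h) ≫ m) n (comm_restrict hm h) :=
  H.map_extend (S.sq h) rfl m n hm _

/-- Each action is an epimorphism. -/
theorem act_hom_ext (a : Ordinal.{v}) {Z : C} {l l' : S.E.obj (Order.succ a) ⟶ Z}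
    (h : S.act a ≫ l = S.act a ≫ l') : l = l' := by
  refine (S.existsUnique_act a (S.act a ≫ l') fun b hb => ?_).unique h rfl
  rw [reassoc_of% S.lam_act a, S.map_map_assoc, reassoc_of% S.act_nat hb.le]

theorem zero (w : t ≫ g = f.hom ≫ n) : ∃! m, S.IsExtension H t n 0 m := by
  have := S.isIso_lam_zero
  refine ⟨inv (S.lam 0) ≫ t, ⟨?_, by simp, fun b hb => absurd hb (not_lt_bot)⟩, fun m hm => ?_⟩
  · rw [Category.assoc, w, IsIso.inv_comp_eq, ← Category.assoc, S.fac]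
  · rw [← hm.lam, IsIso.inv_hom_id_assoc]

/-- The action forces the value of an extension at a successor stage, and the universal property of
the action makes that value available. -/
theorem succ {a : Ordinal.{v}} (ih : ∃! m, S.IsExtension H t n a m) :
    ∃! m, S.IsExtension H t n (Order.succ a) m := by
  obtain ⟨m, hm, hu⟩ := ih
  obtain ⟨l, hl, -⟩ := S.existsUnique_act a (H.extend m n hm.comm) (fun b hb => by
    rw [LiftStr.lam_extend, hm.act b hb (comm_restrict hm.comm _)]
    exact (map_sq_extend hm.comm hb.le).symm)
  have hlm : S.E.map (homOfLE (Order.le_succ a)) ≫ l = m := by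
    rw [← S.lam_act, Category.assoc, hl, LiftStr.lam_extend]
  refine ⟨l, ⟨?_, ?_, fun b hb w => ?_⟩, fun l' hl' => ?_⟩
  · apply act_hom_ext
    rw [← Category.assoc, hl, LiftStr.extend_hom, ← Category.assoc, S.act_rho]
  · rw [← hm.lam, ← hlm, ← Category.assoc, S.lam_map]
  · obtain rfl | hba := (Order.lt_succ_iff.mp hb).eq_or_lt
    · rw [S.map_refl, Category.id_comp, hl]
      exact H.extend_congr hlm.symm _ _
    · rw [← S.map_map_assoc (Order.succ_le_of_lt hba) (Order.le_succ a), hlm,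
        hm.act b hba (comm_restrict hm.comm _)]
      refine H.extend_congr ?_ _ _
      rw [← hlm, S.map_map_assoc]
  · have h := hu _ (hl'.restrict (Order.le_succ a))
    apply act_hom_ext
    have h' := hl'.act a (Order.lt_succ a) (comm_restrict hl'.comm _)
    rw [S.map_refl, Category.id_comp] at h'
    rw [h', hl]
    exact H.extend_congr h _ _

/-- At a limit stage the extensions at earlier stages glue, being compatible by uniqueness. -/
theorem limit {c : Ordinal.{v}} (hc : Order.IsSuccLimit c)
    (ih : ∀ a < c, ∃! m, S.IsExtension H t n a m) : ∃! m, S.IsExtension H t n c m := by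
  choose m hm hu using ih
  obtain ⟨l, hl, -⟩ := S.existsUnique_limit c hc m
    (fun a b h hb => hu a _ _ ((hm b hb).restrict h))
  have hext {Z : C} {x y : S.E.obj c ⟶ Z} (h : ∀ (a : Ordinal.{v}) (ha : a < c),
      S.E.map (homOfLE ha.le) ≫ x = S.E.map (homOfLE ha.le) ≫ y) : x = y :=
    (S.existsUnique_limit c hc (fun a ha => S.E.map (homOfLE ha.le) ≫ y)
      (fun a b h hb => S.map_map_assoc _ _ _)).unique h (fun _ _ => rfl)
  refine ⟨l, ⟨hext fun a ha => ?_, ?_, fun b hb w => ?_⟩, fun l' hl' => hext fun a ha => ?_⟩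
  · rw [← Category.assoc, hl a ha, (hm a ha).comm, ← Category.assoc, S.map_rho]
  · have h0 : 0 < c := hc.bot_lt
    rw [← S.lam_map h0.le, Category.assoc, hl 0 h0, (hm 0 h0).lam]
  · have hb' : Order.succ b < c := hc.succ_lt hb
    have h := (hm _ hb').act b (Order.lt_succ b) (comm_restrict (hm _ hb').comm _)
    rw [S.map_refl, Category.id_comp] at h
    rw [hl _ hb', h]
    refine H.extend_congr ?_ _ _
    rw [← hl _ hb', S.map_map_assoc]
  · rw [hl a ha]
    exact hu a ha _ (hl'.restrict ha.le)

theorem existsUnique (w : t ≫ g = f.hom ≫ n) (a : Ordinal.{v}) :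
    ∃! m, S.IsExtension H t n a m := by
  induction a using Ordinal.limitRecOn with
  | zero => exact zero w
  | add_one a ih => rw [← Order.succ_eq_add_one]; exact succ ih
  | limit c hc ih => exact limit hc ih

end IsExtension

end Extension

section Convergence

variable (a : Ordinal.{v}) [IsIso (S.E.map (homOfLE (Order.le_succ a)))]

/-- Where the sequence has converged, its action becomes an algebra structure on `ρ_a` for the
pointed endofunctor `R¹`, that is, a lifting structure. -/
noncomputable def str : LiftStr J (S.rho a) :=
  LiftStr.ofAct (S.act a ≫ inv (S.E.map (homOfLE (Order.le_succ a))))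
    (by rw [← Category.assoc, S.lam_act, IsIso.hom_inv_id]; rfl)
    (by rw [Category.assoc, IsIso.inv_comp_eq _ |>.mpr (S.map_rho (Order.le_succ a)).symm, S.act_rho])

theorem isFreeLift_str : IsFreeLift (S.str a) (S.lam a) := by
  intro Z W g H t n w
  rw [S.fac] at w
  have key (m : S.E.obj a ⟶ Z) :
      S.IsExtension H t n a m ↔ S.lam a ≫ m = t ∧ LiftMap (S.str a) H m n := by
    constructor
    · intro hm
      refine ⟨hm.lam, (LiftStr.liftMap_ofAct_iff _ _ H hm.comm).mpr ?_⟩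
      obtain ⟨m', hm', -⟩ := IsExtension.existsUnique (S := S) (H := H) w (Order.succ a)
      have h : S.E.map (homOfLE (Order.le_succ a)) ≫ m' = m :=
        (IsExtension.existsUnique (S := S) (H := H) w a).unique
          (hm'.restrict (Order.le_succ a)) hm
      have h' := hm'.act a (Order.lt_succ a) (IsExtension.comm_restrict hm'.comm _)
      rw [S.map_refl, Category.id_comp] at h'
      rw [Category.assoc, (IsIso.inv_comp_eq _).mpr h.symm, h']
      exact H.extend_congr h _ _
    · rintro ⟨hl, hm⟩
      have hp := (LiftStr.liftMap_ofAct_iff _ _ H hm.comm).mp hm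
      refine ⟨hm.comm, hl, fun b hb w' => ?_⟩
      rw [← IsExtension.map_sq_extend hm.comm hb.le, ← hp, Category.assoc,
        reassoc_of% S.act_nat hb.le, ← S.map_map (Order.succ_le_of_lt hb) (Order.le_succ a),
        Category.assoc, IsIso.hom_inv_id_assoc]
  simpa only [key] using IsExtension.existsUnique (S := S) (H := H) w a

end Convergence

end PointwiseSequence


/-! ### Evaluating the free module sequence -/

namespace DomComonad

variable {C : Type u} [Category.{v} C]

theorem pointTensor_app {T : DomComonad C} (τ : 𝟙_ (DomComonad C) ⟶ T) (A : DomComonad C)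
    (f : Arrow C) : Hom.app (pointTensor τ A) f = T.lam (Arrow.mk (A.rho f)) := by
  have h : Hom.app τ (Arrow.mk (A.rho f)) = T.lam (Arrow.mk (A.rho f)) :=
    (Category.id_comp _).symm.trans (Hom.lam τ (Arrow.mk (A.rho f)))
  refine (Category.id_comp _).trans ?_
  exact (congrArg (· ≫ _) (map_homMk_id _ _ _)).trans ((Category.id_comp _).trans h)

theorem whiskerLeft_app (T : DomComonad C) {A B : DomComonad C} (a : A ⟶ B) (f : Arrow C) :
    Hom.app (T ◁ a) f = T.E.map (Hom.mapR a f) := Category.comp_id _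

end DomComonad

namespace FreeModuleSequence

open DomComonad

variable {C : Type u} [Category.{v} C] [HasColimits C] {ι : Type v} {J : ι → Arrow C}
  (X : FreeModuleSequence.{v} (oneStepPoint J) (𝟙_ (DomComonad C))) (f : Arrow C)

theorem isConnected_Iio {c : Ordinal.{v}} (hc : Order.IsSuccLimit c) :
    CategoryTheory.IsConnected (Set.Iio c) := by
  have : Nonempty (Set.Iio c) := ⟨⟨0, hc.bot_lt⟩⟩
  exact IsFiltered.isConnected _

theorem hasColimitsOfShape_Iio (c : Ordinal.{v}) : HasColimitsOfShape (Set.Iio c) C :=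
  hasColimitsOfShape_of_essentiallySmall.{v} (Set.Iio c) C

theorem existsUnique_app_of_isSuccLimit {c : Ordinal.{v}} (hc : Order.IsSuccLimit c) {Z : C}
    (k : ∀ a < c, (X.X.obj a).E.obj f ⟶ Z)
    (hk : ∀ (a b : Ordinal.{v}) (h : a ≤ b) (hb : b < c),
      Hom.app (X.X.map (homOfLE h)) f ≫ k b hb = k a (h.trans_lt hb)) :
    ∃! l : (X.X.obj c).E.obj f ⟶ Z,
      ∀ (a : Ordinal.{v}) (h : a < c), Hom.app (X.X.map (homOfLE h.le)) f ≫ l = k a h := by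
  have := isConnected_Iio hc
  have := hasColimitsOfShape_Iio (C := C) c
  have hcol := isColimitOfPreserves (ev f) (X.continuous.nonempty_isColimit c hc).some
  let s : Cocone (((Set.principalSegIio c).monotone.functor ⋙ X.X) ⋙ ev f) :=
    { pt := Z
      ι :=
        { app := fun a => k a.1 a.2
          naturality := fun a b u => (hk a.1 b.1 (leOfHom u) b.2).trans (Category.comp_id _).symm } }
  exact ⟨hcol.desc s, fun a h => hcol.fac s ⟨a, h⟩,
    fun l hl => hcol.hom_ext fun a => (hl a.1 a.2).trans (hcol.fac s a).symm⟩

/-- At every stage the action is, pointwise, universal among maps that are compatible with the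
actions at all smaller stages. At `0` the action is invertible; at successor and limit stages it is
a connected colimit of comonads over `dom`, hence a pointwise one. -/
theorem existsUnique_app_act (a : Ordinal.{v}) {Z : C}
    (k : OneStep.obj J (Arrow.mk ((X.X.obj a).rho f)) ⟶ Z)
    (hk : ∀ (b : Ordinal.{v}) (h : b < a),
      Hom.app (X.act b) f ≫ Hom.app (X.X.map (homOfLE (Order.succ_le_of_lt h))) f ≫
        OneStep.lam J (Arrow.mk ((X.X.obj a).rho f)) ≫ k =
      OneStep.map J (Hom.mapR (X.X.map (homOfLE h.le)) f) ≫ k) :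
    ∃! l : (X.X.obj (Order.succ a)).E.obj f ⟶ Z, Hom.app (X.act a) f ≫ l = k := by
  let T := OneStep.comonad J
  -- The values at `f` of the two kinds of maps that an action coequalises.
  have hpoint (A : DomComonad C) : (ev f).map (pointTensor (oneStepPoint J) A) =
      OneStep.lam J (Arrow.mk (A.rho f)) := pointTensor_app _ A f
  have hmap {A B : DomComonad C} (t : A ⟶ B) : (ev f).map (T ◁ t) =
      OneStep.map J (Hom.mapR t f) := whiskerLeft_app T t f
  obtain rfl | ⟨b, rfl⟩ | hc := Ordinal.zero_or_succ_or_isSuccLimit a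
  · have := X.isIso_act_zero
    have : IsIso (Hom.app (X.act 0) f) := (ev f).map_isIso (X.act 0)
    exact ⟨inv (Hom.app (X.act 0) f) ≫ k, IsIso.hom_inv_id_assoc _ _,
      fun l hl => (IsIso.eq_inv_comp _).mpr hl⟩
  · have hcol := isColimitCoforkMapOfIsColimit (ev f) _ (X.isColimit_succ b).some
    refine Cofork.IsColimit.existsUnique hcol k ?_
    have e₁ : (ev f).map (X.act b ≫ pointTensor (oneStepPoint J) (X.X.obj (Order.succ b))) ≫ k =
        Hom.app (X.act b) f ≫ OneStep.lam J (Arrow.mk ((X.X.obj (Order.succ b)).rho f)) ≫ k :=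
      (congrArg (fun t => (Hom.app (X.act b) f ≫ t) ≫ k) (hpoint _)).trans (Category.assoc _ _ _)
    have e₂ : T ◁ pointTensor (oneStepPoint J) (X.X.obj b) ≫ T ◁ X.act b =
        T ◁ X.X.map (homOfLE (Order.le_succ b)) := by
      rw [← MonoidalCategory.whiskerLeft_comp, X.point_act]
    have e₃ : Hom.app (X.X.map (homOfLE (le_refl (Order.succ b)))) f = 𝟙 _ :=
      congrArg (fun t => Hom.app t f) (X.X.map_id (Order.succ b))
    refine e₁.trans (Eq.trans ?_ ((hk b (Order.lt_succ b)).trans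
      (congrArg (· ≫ k) ((congrArg (ev f).map e₂).trans (hmap _)).symm)))
    exact congrArg (Hom.app (X.act b) f ≫ ·)
      ((Category.id_comp _).symm.trans (congrArg (· ≫ _) e₃.symm))
  · have := isConnected_Iio hc
    have := hasColimitsOfShape_Iio (C := C) a
    let D : Set.Iio a ⥤ DomComonad C :=
      ((Set.principalSegIio a).monotone.functor ⋙ X.X) ⋙ tensorLeft T
    have hlt (b : Set.Iio a) : b.1 < a := b.2
    let p : colimit D ⟶ T ⊗ X.X.obj a := colimit.desc D
      { pt := T ⊗ X.X.obj a
        ι :=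
          { app := fun b => X.act b.1 ≫ X.X.map (homOfLE (Order.succ_le_of_lt (hlt b))) ≫
              pointTensor (oneStepPoint J) (X.X.obj a)
            naturality := fun b b' u => by
              refine Eq.trans ?_ (Category.comp_id _).symm
              change T ◁ X.X.map (homOfLE (leOfHom u)) ≫ X.act b'.1 ≫ _ = _
              rw [← Category.assoc, X.act_nat, Category.assoc, ← X.X.map_comp_assoc]
              rfl } }
    let q : colimit D ⟶ T ⊗ X.X.obj a := colimit.desc D
      { pt := T ⊗ X.X.obj a
        ι :=
          { app := fun b => T ◁ X.X.map (homOfLE (le_of_lt (hlt b)))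
            naturality := fun b b' u => by
              refine Eq.trans ?_ (Category.comp_id _).symm
              exact (MonoidalCategory.whiskerLeft_comp _ _ _).symm.trans
                (congrArg (T ◁ ·) (X.X.map_comp _ _).symm) } }
    have hp (b : Set.Iio a) : colimit.ι D b ≫ p = X.act b.1 ≫
        X.X.map (homOfLE (Order.succ_le_of_lt (hlt b))) ≫ pointTensor (oneStepPoint J) (X.X.obj a) :=
      colimit.ι_desc _ _
    have hq (b : Set.Iio a) : colimit.ι D b ≫ q = T ◁ X.X.map (homOfLE (le_of_lt (hlt b))) :=
      colimit.ι_desc _ _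
    have w : p ≫ X.act a = q ≫ X.act a := colimit.hom_ext fun b => by
      rw [reassoc_of% hp b, reassoc_of% hq b]
      exact ((Category.assoc _ _ _).trans (congrArg (X.act b.1 ≫ ·) (Category.assoc _ _ _))).trans
        (X.condition_limit a hc b.1 b.2)
    have hcofork : IsColimit (Cofork.ofπ (X.act a) w) :=
      Cofork.IsColimit.ofExistsUnique fun s => X.existsUnique_limit a hc s.π fun b h => by
        have h' := colimit.ι D ⟨b, h⟩ ≫= s.condition
        rw [reassoc_of% hp ⟨b, h⟩, reassoc_of% hq ⟨b, h⟩] at h'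
        exact ((Category.assoc _ _ _).trans
          (congrArg (X.act b ≫ ·) (Category.assoc _ _ _))).symm.trans h'
    refine Cofork.IsColimit.existsUnique (isColimitCoforkMapOfIsColimit (ev f) _ hcofork) k
      ((isColimitOfPreserves (ev f) (colimit.isColimit D)).hom_ext fun b => ?_)
    have e₁ : (ev f).map (colimit.ι D b) ≫ (ev f).map p ≫ k = Hom.app (X.act b.1) f ≫
        Hom.app (X.X.map (homOfLE (Order.succ_le_of_lt (hlt b)))) f ≫
          OneStep.lam J (Arrow.mk ((X.X.obj a).rho f)) ≫ k := by
      refine (Category.assoc _ _ _).symm.trans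
        ((congrArg (fun t => (ev f).map t ≫ k) (hp b)).trans ?_)
      refine (congrArg (fun t => (Hom.app (X.act b.1) f ≫
        Hom.app (X.X.map (homOfLE (Order.succ_le_of_lt (hlt b)))) f ≫ t) ≫ k) (hpoint _)).trans ?_
      exact (Category.assoc _ _ _).trans (congrArg (Hom.app (X.act b.1) f ≫ ·)
        (Category.assoc _ _ _))
    have e₂ : (ev f).map (colimit.ι D b) ≫ (ev f).map q ≫ k =
        OneStep.map J (Hom.mapR (X.X.map (homOfLE (le_of_lt (hlt b)))) f) ≫ k := by
      refine (Category.assoc _ _ _).symm.trans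
        ((congrArg (fun t => (ev f).map t ≫ k) (hq b)).trans ?_)
      exact congrArg (· ≫ k) (hmap _)
    exact e₁.trans ((hk b.1 b.2).trans e₂.symm)

/-- The value of a free module sequence at an arrow. -/
noncomputable def pointwise : PointwiseSequence J f where
  E := X.X ⋙ ev f
  lam a := (X.X.obj a).lam f
  rho a := (X.X.obj a).rho f
  lam_map h := Hom.lam (X.X.map (homOfLE h)) f
  map_rho h := Hom.rho (X.X.map (homOfLE h)) f
  fac a := (X.X.obj a).fac f
  act a := Hom.app (X.act a) f
  lam_act a := (congrArg (· ≫ Hom.app (X.act a) f)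
    (pointTensor_app (oneStepPoint J) (X.X.obj a) f).symm).trans
      (congrArg (fun t => Hom.app t f) (X.point_act a))
  act_rho a := Hom.rho (X.act a) f
  act_nat h := (congrArg (· ≫ Hom.app (X.act _) f)
    (whiskerLeft_app (OneStep.comonad J) (X.X.map (homOfLE h)) f).symm).trans
      (congrArg (fun t => Hom.app t f) (X.act_nat h))
  isIso_lam_zero := by
    let e : (X.X.obj 0).E.obj f ≅ f.left := (ev f).mapIso X.zero
    have h : (X.X.obj 0).lam f ≫ e.hom = 𝟙 f.left := Hom.lam X.zero.hom f
    have h' : (X.X.obj 0).lam f = e.inv := e.comp_hom_eq_id.mp h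
    rw [h']
    exact e.isIso_inv
  existsUnique_act a _ k hk := X.existsUnique_app_act f a k hk
  existsUnique_limit c hc _ k hk := X.existsUnique_app_of_isSuccLimit f hc k hk

/-- If the sequence converges pointwise, then its limiting values are free lifting structures. -/
theorem nonempty_freeLifts (hX : ConvergesPointwise X) : Nonempty (FreeLifts J) := by
  choose a ha using hX
  have (f : Arrow C) : IsIso ((X.pointwise f).E.map (homOfLE (Order.le_succ (a f)))) := ha f
  exact ⟨{
    E := fun f => (X.pointwise f).E.obj (a f)
    lam := fun f => (X.pointwise f).lam (a f)
    rho := fun f => (X.pointwise f).rho (a f)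
    fac := fun f => (X.pointwise f).fac (a f)
    str := fun f => (X.pointwise f).str (a f)
    free := fun f => (X.pointwise f).isFreeLift_str (a f) }⟩

end FreeModuleSequence

end Garner

theorem mainTheorem2 {C : Type u} [Category.{v} C] [HasColimits C] {ι : Type v}
    (J : ι → Arrow C)
    (X : Garner.FreeModuleSequence.{v} (Garner.oneStepPoint J) (𝟙_ (Garner.DomComonad C)))
    (hX : Garner.ConvergesPointwise X)
    (U : Mon (Garner.DomComonad C)) (χ : Garner.OneStep.comonad J ⟶ U.X)
    (hU : Garner.IsFreeMonoid (Garner.oneStepPoint J) U χ) :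
    (Garner.NWFS.ofMon U).CofibrantlyGenerated J (Garner.inducedStructure χ) := by
  obtain ⟨F⟩ := X.nonempty_freeLifts hX
  exact Garner.NWFS.cofibrantlyGenerated_of_isFreeLift _ _ (F.isFreeLift_of_isFreeMonoid hU)
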